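/- All graphs are finite, simple and undirected. For a graph $H$ without isolated vertices, a total dominating set is a set $S\subseteq V(H)$ such that every vertex of $H$ is adjacent to at least one vertex of $S$, and $\gamma_t(H)$ denotes the minimum cardinality of a total dominating set. For a graph $G$ and an integer $k\ge 0$, let $b_t^k(G)$ be the minimum cardinality of a set $D\subseteq E(G)$ such that $G\setminus D$ (the graph on $V(G)$ with the edges in $D$ deleted) has no isolated vertices and $\gamma_t(G\setminus D)\ge \gamma_t(G)+k$; we say that $b_t^k(G)$ exists if there is at least one such set $D$ (in particular $G$ then has no isolated vertices). Let $G$ be a graph on $n\ge 5$ vertices and let $k\ge 0$ be an integer with $k\le n-2+\frac{(-1)^n-1}{2}$. Then $b_t^k(K_n)$ exists, and if $b_t^k(G)$ exists, then $$b_t^k(G)\le b_t^k(K_n).$$ -/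

import Mathlib

namespace TotalBondage

variable {V : Type*} [Fintype V]

/-- The graph `G` has no isolated vertex. -/
def NoIsolatedVertex (G : SimpleGraph V) : Prop :=
  ∀ v : V, ¬ G.IsIsolated v

/-- `S` is a total dominating set of `G`: every vertex of `G` (also those in `S`) is adjacent to
at least one vertex of `S`. -/
def IsTotalDominatingSet (G : SimpleGraph V) (S : Finset V) : Prop :=
  ∀ v : V, ∃ w ∈ S, G.Adj v w

/-- The total domination number of `G`: the least cardinality of a total dominating set.
It is meaningful for graphs without isolated vertices, which are exactly the graphs that have a
total dominating set; below it is only used for those. -/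
noncomputable def totalDominationNumber (G : SimpleGraph V) : ℕ :=
  sInf {m : ℕ | ∃ S : Finset V, IsTotalDominatingSet G S ∧ S.card = m}

/-- `D` is a set of edges of `G` whose deletion leaves a graph without isolated vertices and
increases the total domination number by at least `k`. Since a graph with fewer edges has no
isolated vertex, `G` has none either when such a `D` exists. -/
def IsBondageSet (G : SimpleGraph V) (k : ℕ) (D : Finset (Sym2 V)) : Prop :=
  (D : Set (Sym2 V)) ⊆ G.edgeSet ∧
  NoIsolatedVertex (G.deleteEdges (D : Set (Sym2 V))) ∧
  totalDominationNumber G + k ≤ totalDominationNumber (G.deleteEdges (D : Set (Sym2 V)))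

/-- The `k`-total bondage number of `G` exists: some deletion of edges increases the total
domination number by at least `k`. -/
def BondageNumberExists (G : SimpleGraph V) (k : ℕ) : Prop :=
  ∃ D : Finset (Sym2 V), IsBondageSet G k D

/-- The `k`-total bondage number of `G`: the least number of edges that must be deleted from `G`
to increase the total domination number by at least `k`. It is meaningful when
`BondageNumberExists G k` holds. -/
noncomputable def bondageNumber (G : SimpleGraph V) (k : ℕ) : ℕ :=
  sInf {m : ℕ | ∃ D : Finset (Sym2 V), IsBondageSet G k D ∧ D.card = m}

end TotalBondage

/-!
Write `n` for the number of vertices, and call twice the largest number of edges in a matching of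
`G` its matching bound. The proof computes a number `budget n k`, about `k (n - 1) - k² / 2`, which
bounds `b_t^k(K_n)` from below and `b_t^k(G)` from above for every `G` for which it exists.

*Lower bound for the complete graph.* If `D` is a bondage set of `K_n`, then `H = K_n - D` has no
isolated vertex and total domination number at least `t = k + 2`, so the claim is an upper bound on
the size of `H`. With `p = n - t` it has at most `(n + p² + 2 p) / 2` edges
(`degSum_le_of_le_card`) and, for odd `t` and `p ≥ 2`, at most `(n + p² + 1) / 2` edges
(`degSum_le_of_le_card_of_odd`). Both are proved in the manner of Vizing: take a vertex `v` of
maximum degree and let `X` be the set of vertices outside its closed neighbourhood. A neighbour `y`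
of `v` has few neighbours in `X`, because `v` and `y` together dominate everything but the rest of `X`,
and `X` itself is hard to dominate, so that induction applies to it. In the odd case the tight
situations are treated separately; the essential one is that of at most one neighbour in `X`
for each `y` (`two_mul_sum_degIn_le`).

*Upper bound for all graphs.* The vertices covered by a maximum matching form a total dominating
set, so if `b_t^k(G)` exists, then `γ_t(G) + k` is at most the matching bound of `G`. Conversely, in
a graph all of whose components are stars and triangles the total domination number is at least
the matching bound (`card_support_le_of_inactive`), so there is room for a gain only if other
components exist; their vertices are called active. As long as there is room, two can be gained by
deleting at most `2 s - 4` edges, where `s` is the number of active vertices, in such a way that the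
matching bound does not drop and at least two vertices become inactive (`exists_step_two`); summing
up over `k / 2` steps gives `budget n k` for even `k`, and for odd `k` a last step gains one
(`exists_step_one`).

The mechanism of each step is to make an edge `xy` (or a star) a component of its own. A total
dominating set of the new graph contains `x` and `y`, but omitting them may leave `x` undominated in
the old graph. To prevent this, a helper vertex `w` is chosen and its edges to non-neighbours of
`x` are deleted, except to leaves in the case of a star: then whatever dominates `w` also dominates
`x`, or is a leaf that can be exchanged for a vertex that does. This costs at most as many edges as
`x` has non-neighbours, so that together with the edges at `x` one pays for `s - 1` pairs only,
whatever the degree of `x` is (`isStep_pairCut`, `isStep_starCut`).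
-/

namespace TotalBondage

/-! ### The size of graphs with large total domination number -/

section Size

open scoped Classical

variable {V : Type*}

/-- The number of neighbours of `u` inside `U`. -/
noncomputable def degIn (G : SimpleGraph V) (U : Finset V) (u : V) : ℕ :=
  (U.filter (G.Adj u)).card

/-- The sum of the degrees of the graph induced on `U`, that is, twice its number of edges. -/
noncomputable def degSum (G : SimpleGraph V) (U : Finset V) : ℕ :=
  ∑ u ∈ U, degIn G U u

/-- Every vertex of `U` has a neighbour in `T`. -/
def Dominates (G : SimpleGraph V) (T U : Finset V) : Prop :=
  ∀ u ∈ U, ∃ w ∈ T, G.Adj u w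

variable {G : SimpleGraph V}

lemma degIn_union {A B : Finset V} (h : Disjoint A B) (u : V) :
    degIn G (A ∪ B) u = degIn G A u + degIn G B u := by
  unfold degIn
  rw [Finset.filter_union, Finset.card_union_of_disjoint]
  exact Finset.disjoint_filter_filter h

lemma sum_degIn_comm (A B : Finset V) :
    ∑ a ∈ A, degIn G B a = ∑ b ∈ B, degIn G A b := by
  simp only [degIn, Finset.card_filter]
  rw [Finset.sum_comm]
  simp only [G.adj_comm]

lemma degSum_union {A B : Finset V} (h : Disjoint A B) :
    degSum G (A ∪ B) = degSum G A + degSum G B + 2 * ∑ a ∈ A, degIn G B a := by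
  unfold degSum
  rw [Finset.sum_union h]
  simp only [degIn_union h, Finset.sum_add_distrib]
  rw [sum_degIn_comm B A]
  ring

lemma degIn_singleton_self (a : V) : degIn G {a} a = 0 := by
  simp [degIn]

lemma even_degSum (U : Finset V) : Even (degSum G U) := by
  induction U using Finset.induction_on with
  | empty => simp [degSum]
  | insert a U ha ih =>
    rw [Finset.insert_eq, degSum_union (by simpa using ha)]
    have : degSum G {a} = 0 := by simp [degSum, degIn_singleton_self]
    rw [this]
    simpa using ih.add (even_two_mul _)

lemma degIn_le_card_erase {U : Finset V} {u : V} : degIn G U u ≤ (U.erase u).card := by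
  apply Finset.card_le_card
  intro w hw
  rw [Finset.mem_filter] at hw
  exact Finset.mem_erase.2 ⟨hw.2.ne', hw.1⟩

lemma degSum_le (U : Finset V) : (degSum G U : ℤ) ≤ U.card * (U.card - 1) := by
  have : degSum G U ≤ ∑ u ∈ U, (U.card - 1) := Finset.sum_le_sum fun u hu => by
    rw [← Finset.card_erase_of_mem hu]
    exact degIn_le_card_erase
  rw [Finset.sum_const, smul_eq_mul] at this
  rcases U.eq_empty_or_nonempty with rfl | h
  · simp [degSum]
  · have h1 := h.card_pos
    zify [h1] at this
    exact this

lemma card_le_degSum {U : Finset V} (h : Dominates G U U) : U.card ≤ degSum G U := by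
  rw [Finset.card_eq_sum_ones]
  refine Finset.sum_le_sum fun u hu => ?_
  obtain ⟨w, hw, hadj⟩ := h u hu
  exact Finset.card_pos.2 ⟨w, by simp [hw, hadj]⟩

/-- Vertices that a set `S` leaves undominated can be dominated by one further vertex each. -/
lemma le_card_add_card {U : Finset V} (hU : Dominates G U U) {t : ℤ}
    (ht : ∀ T ⊆ U, Dominates G T U → t ≤ T.card) {S Z : Finset V} (hS : S ⊆ U)
    (h : ∀ u ∈ U, u ∈ Z ∨ ∃ w ∈ S, G.Adj u w) : t ≤ S.card + Z.card := by
  choose! f hf hadj using hU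
  have := ht (S ∪ (U ∩ Z).image f) (Finset.union_subset hS (by
      intro x hx
      obtain ⟨a, ha, rfl⟩ := Finset.mem_image.1 hx
      exact hf a (Finset.mem_inter.1 ha).1)) (by
      intro u hu
      rcases h u hu with hz | ⟨w, hw, ha⟩
      · exact ⟨f u, Finset.mem_union_right _
          (Finset.mem_image_of_mem _ (Finset.mem_inter.2 ⟨hu, hz⟩)), hadj u hu⟩
      · exact ⟨w, Finset.mem_union_left _ hw, ha⟩)
  have h1 := Finset.card_union_le S ((U ∩ Z).image f)
  have h2 : ((U ∩ Z).image f).card ≤ (U ∩ Z).card := Finset.card_image_le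
  have h3 := Finset.card_le_card (Finset.inter_subset_right (s₁ := U) (s₂ := Z))
  have h4 : (S ∪ (U ∩ Z).image f).card ≤ S.card + Z.card := by omega
  exact this.trans (by exact_mod_cast h4)

/-- The vertices of `U` other than `v` that are not adjacent to `v`. -/
noncomputable def farFrom (G : SimpleGraph V) (U : Finset V) (v : V) : Finset V :=
  U.filter fun u => u ≠ v ∧ ¬ G.Adj v u

lemma mem_farFrom {U : Finset V} {u v : V} :
    u ∈ farFrom G U v ↔ u ∈ U ∧ u ≠ v ∧ ¬ G.Adj v u := by
  simp [farFrom]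

lemma eq_union_farFrom {U : Finset V} {v : V} (hv : v ∈ U) :
    U = {v} ∪ (U.filter (G.Adj v) ∪ farFrom G U v) := by
  ext u
  simp only [Finset.mem_union, Finset.mem_singleton, Finset.mem_filter, mem_farFrom]
  constructor
  · intro hu
    by_cases h1 : u = v
    · exact Or.inl h1
    · by_cases h2 : G.Adj v u
      · exact Or.inr (Or.inl ⟨hu, h2⟩)
      · exact Or.inr (Or.inr ⟨hu, h1, h2⟩)
  · rintro (rfl | h | h)
    exacts [hv, h.1, h.1]

lemma disjoint_filter_farFrom {U : Finset V} {v : V} :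
    Disjoint (U.filter (G.Adj v)) (farFrom G U v) := by
  rw [Finset.disjoint_left]
  intro a ha hb
  exact (mem_farFrom.1 hb).2.2 (Finset.mem_filter.1 ha).2

lemma disjoint_singleton_farFrom {U : Finset V} {v : V} :
    Disjoint {v} (U.filter (G.Adj v) ∪ farFrom G U v) := by
  simp [mem_farFrom]

lemma card_eq_farFrom {U : Finset V} {v : V} (hv : v ∈ U) :
    U.card = 1 + degIn G U v + (farFrom G U v).card := by
  conv_lhs => rw [eq_union_farFrom (G := G) hv]
  rw [Finset.card_union_of_disjoint disjoint_singleton_farFrom,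
    Finset.card_union_of_disjoint disjoint_filter_farFrom, Finset.card_singleton, degIn]
  ring

lemma degSum_eq_farFrom {U : Finset V} {v : V} (hv : v ∈ U) :
    degSum G U = 2 * degIn G U v + degSum G (U.filter (G.Adj v)) +
      2 * ∑ y ∈ U.filter (G.Adj v), degIn G (farFrom G U v) y + degSum G (farFrom G U v) := by
  conv_lhs => rw [eq_union_farFrom (G := G) hv]
  rw [degSum_union disjoint_singleton_farFrom, degSum_union disjoint_filter_farFrom]
  have h1 : degSum G {v} = 0 := by simp [degSum, degIn_singleton_self]
  have h2 : degIn G (U.filter (G.Adj v) ∪ farFrom G U v) v = degIn G U v := by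
    unfold degIn
    congr 1
    ext u
    simp only [Finset.mem_union, Finset.mem_filter, mem_farFrom]
    tauto
  rw [h1, Finset.sum_singleton, h2]
  ring

/-- If `v` has maximum degree `Δ`, the vertices of its closed neighbourhood have degree sum at
most `Δ + Δ²`. -/
lemma degSum_le_farFrom {U : Finset V} {v : V} (hv : v ∈ U)
    (hmax : ∀ u ∈ U, degIn G U u ≤ degIn G U v) :
    degSum G U ≤ degIn G U v + degIn G U v * degIn G U v +
      ∑ y ∈ U.filter (G.Adj v), degIn G (farFrom G U v) y + degSum G (farFrom G U v) := by
  rw [degSum_eq_farFrom hv]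
  have h : ∀ y ∈ U.filter (G.Adj v),
      1 + degIn G (U.filter (G.Adj v)) y + degIn G (farFrom G U v) y ≤ degIn G U v := by
    intro y hy
    have hy' := Finset.mem_filter.1 hy
    refine le_trans (le_of_eq ?_) (hmax y hy'.1)
    conv_rhs => rw [eq_union_farFrom (G := G) hv]
    rw [degIn_union disjoint_singleton_farFrom, degIn_union disjoint_filter_farFrom]
    have : degIn G {v} y = 1 := by
      simp [degIn, Finset.filter_singleton, hy'.2.symm]
    rw [this]; ring
  have h2 := Finset.sum_le_sum h
  simp only [Finset.sum_add_distrib, Finset.sum_const, smul_eq_mul, mul_one] at h2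
  change degIn G U v + degSum G (U.filter (G.Adj v)) + _ ≤ degIn G U v * degIn G U v at h2
  omega

/-- Every neighbour `y` of `v` satisfies `|N(y) ∩ X| ≤ |X| + 2 - t`, where `X` consists of the
vertices far from `v`: the pair `v, y` dominates everything but the rest of `X`. -/
lemma degIn_farFrom_le {U : Finset V} (hU : Dominates G U U) {t : ℤ}
    (ht : ∀ T ⊆ U, Dominates G T U → t ≤ T.card) {v y : V} (hv : v ∈ U)
    (hy : y ∈ U.filter (G.Adj v)) :
    (degIn G (farFrom G U v) y : ℤ) ≤ (farFrom G U v).card + 2 - t := by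
  rw [Finset.mem_filter] at hy
  have h := le_card_add_card hU ht (S := {v, y}) (Z := (farFrom G U v).filter (¬ G.Adj y ·))
    (by simp [Finset.insert_subset_iff, hv, hy.1]) (by
      intro u hu
      by_cases h1 : u = v
      · exact Or.inr ⟨y, by simp, h1 ▸ hy.2⟩
      by_cases h2 : G.Adj v u
      · exact Or.inr ⟨v, by simp, h2.symm⟩
      by_cases h3 : G.Adj y u
      · exact Or.inr ⟨y, by simp, h3.symm⟩
      · exact Or.inl (Finset.mem_filter.2 ⟨mem_farFrom.2 ⟨hu, h1, h2⟩, h3⟩))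
  have h1 : ({v, y} : Finset V).card ≤ 2 := Finset.card_le_two
  have h2 := Finset.card_filter_add_card_filter_not (s := farFrom G U v) (G.Adj y)
  unfold degIn
  omega

/-- The vertices far from `v` that are isolated among themselves can be discarded without changing
the degree sum; the remaining vertices are hard to dominate. -/
lemma exists_residual {U : Finset V} (hU : Dominates G U U) {t : ℤ}
    (ht : ∀ T ⊆ U, Dominates G T U → t ≤ T.card) {v : V} (hv : v ∈ U) :
    ∃ X₀ ⊆ farFrom G U v, Dominates G X₀ X₀ ∧ degSum G X₀ = degSum G (farFrom G U v) ∧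
      ((X₀ = farFrom G U v ∧ ∀ T ⊆ X₀, Dominates G T X₀ → t - 2 ≤ T.card) ∨
        (X₀.card < (farFrom G U v).card ∧ ∀ T ⊆ X₀, Dominates G T X₀ →
          t - 1 - ((farFrom G U v).card - X₀.card) ≤ T.card)) := by
  set X := farFrom G U v with hX
  have hXU : X ⊆ U := Finset.filter_subset _ _
  set X₀ := X.filter fun x => ∃ w ∈ X, G.Adj x w with hX₀
  have hsub : X₀ ⊆ X := Finset.filter_subset _ _
  have hmem : ∀ x ∈ X, ∀ w ∈ X, G.Adj x w → w ∈ X₀ := fun x hx w hw h =>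
    Finset.mem_filter.2 ⟨hw, x, hx, h.symm⟩
  obtain ⟨y₀, hy₀, hvy₀⟩ := hU v hv
  refine ⟨X₀, hsub, ?_, ?_, ?_⟩
  · intro x hx
    obtain ⟨hx, w, hw, h⟩ := Finset.mem_filter.1 hx
    exact ⟨w, hmem x hx w hw h, h⟩
  · have h0 : ∀ x ∈ X, x ∉ X₀ → degIn G X x = 0 := by
      intro x hx hn
      rw [degIn, Finset.card_eq_zero, Finset.filter_eq_empty_iff]
      intro w hw h
      exact hn (Finset.mem_filter.2 ⟨hx, w, hw, h⟩)
    unfold degSum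
    rw [← Finset.sum_subset hsub h0]
    refine Finset.sum_congr rfl fun x hx => ?_
    unfold degIn
    congr 1
    ext w
    simp only [Finset.mem_filter]
    constructor
    · rintro ⟨h1, h2⟩; exact ⟨hsub h1, h2⟩
    · rintro ⟨h1, h2⟩; exact ⟨hmem x (hsub hx) w h1 h2, h2⟩
  · rcases Finset.eq_empty_or_nonempty (X \ X₀) with he | ⟨a, ha⟩
    · have hXX : X₀ = X := Finset.Subset.antisymm hsub (Finset.sdiff_eq_empty_iff_subset.1 he)
      refine Or.inl ⟨hXX, fun T hT hdom => ?_⟩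
      have h := le_card_add_card hU ht (S := {v, y₀} ∪ T) (Z := ∅)
        (Finset.union_subset (by simp [Finset.insert_subset_iff, hv, hy₀])
          ((hT.trans hsub).trans hXU)) (by
        intro u hu
        right
        by_cases h1 : u = v
        · exact ⟨y₀, by simp, h1 ▸ hvy₀⟩
        by_cases h2 : G.Adj v u
        · exact ⟨v, by simp, h2.symm⟩
        obtain ⟨w, hw, h⟩ := hdom u (hXX ▸ mem_farFrom.2 ⟨hu, h1, h2⟩)
        exact ⟨w, Finset.mem_union_right _ hw, h⟩)
      have h1 := Finset.card_union_le ({v, y₀} : Finset V) T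
      have h2 : ({v, y₀} : Finset V).card ≤ 2 := Finset.card_le_two
      simp only [Finset.card_empty] at h
      omega
    · obtain ⟨haX, haX₀⟩ := Finset.mem_sdiff.1 ha
      have hcard := Finset.card_sdiff_add_card_eq_card hsub
      have hpos := Finset.card_pos.2 ⟨a, ha⟩
      obtain ⟨b, hb, hab⟩ := hU a (hXU haX)
      have hvb : G.Adj v b := by
        by_contra hn
        refine haX₀ (Finset.mem_filter.2 ⟨haX, b, mem_farFrom.2 ⟨hb, ?_, hn⟩, hab⟩)
        rintro rfl
        exact (mem_farFrom.1 haX).2.2 hab.symm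
      refine Or.inr ⟨by omega, fun T hT hdom => ?_⟩
      have h := le_card_add_card hU ht (S := {v, b} ∪ T) (Z := (X \ X₀).erase a)
        (Finset.union_subset (by simp [Finset.insert_subset_iff, hv, hb])
          ((hT.trans hsub).trans hXU)) (by
        intro u hu
        by_cases h1 : u = v
        · exact Or.inr ⟨b, by simp, h1 ▸ hvb⟩
        by_cases h2 : G.Adj v u
        · exact Or.inr ⟨v, by simp, h2.symm⟩
        have huX : u ∈ X := mem_farFrom.2 ⟨hu, h1, h2⟩
        by_cases h3 : u ∈ X₀
        · obtain ⟨w, hw, h⟩ := hdom u h3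
          exact Or.inr ⟨w, Finset.mem_union_right _ hw, h⟩
        by_cases h4 : u = a
        · exact Or.inr ⟨b, by simp, h4 ▸ hab⟩
        · exact Or.inl (Finset.mem_erase.2 ⟨h4, Finset.mem_sdiff.2 ⟨huX, h3⟩⟩))
      have h1 := Finset.card_union_le ({v, b} : Finset V) T
      have h2 : ({v, b} : Finset V).card ≤ 2 := Finset.card_le_two
      rw [Finset.card_erase_of_mem ha] at h
      omega

/-- A graph on `n` vertices whose total dominating sets have at least `t = n - p` elements has
at most `(n + p² + 2p) / 2` edges. -/
theorem degSum_le_of_le_card (U : Finset V) (hU : Dominates G U U) (t : ℤ)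
    (ht : ∀ T ⊆ U, Dominates G T U → t ≤ T.card) :
    (degSum G U : ℤ) ≤ U.card + (U.card - t) ^ 2 + 2 * (U.card - t) := by
  induction hn : U.card using Nat.strong_induction_on generalizing U t with
  | _ n ih =>
  subst hn
  have htU := ht U subset_rfl hU
  rcases U.eq_empty_or_nonempty with rfl | hne
  · simp only [Finset.card_empty, Nat.cast_zero] at htU ⊢
    simp only [degSum, Finset.sum_empty, Nat.cast_zero]
    nlinarith
  obtain ⟨v, hv, hmax⟩ := Finset.exists_max_image U (degIn G U) hne
  obtain ⟨y, hy, hvy⟩ := hU v hv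
  have hyN : y ∈ U.filter (G.Adj v) := Finset.mem_filter.2 ⟨hy, hvy⟩
  have hΔ : 1 ≤ degIn G U v := Finset.card_pos.2 ⟨y, hyN⟩
  have hcard := card_eq_farFrom (G := G) hv
  have hr := degIn_farFrom_le hU ht hv hyN
  have hle := degSum_le_farFrom hv hmax
  have hc : (∑ y ∈ U.filter (G.Adj v), (degIn G (farFrom G U v) y : ℤ)) ≤
      degIn G U v * ((farFrom G U v).card + 2 - t) := by
    have := Finset.sum_le_card_nsmul _ _ _
      (fun y hy => degIn_farFrom_le hU ht hv (y := y) hy)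
    rwa [nsmul_eq_mul] at this
  obtain ⟨X₀, hsub, hdom, hdeg, hcase⟩ := exists_residual hU ht hv
  have hX₀ : X₀.card ≤ (farFrom G U v).card := Finset.card_le_card hsub
  have hlt : X₀.card < U.card := by omega
  rcases hΔ.eq_or_lt with h1 | h1
  · have : degSum G U ≤ ∑ u ∈ U, 1 := Finset.sum_le_sum fun u hu => by
      rw [h1]; exact hmax u hu
    rw [Finset.sum_const, smul_eq_mul, mul_one] at this
    have h3 : (degSum G U : ℤ) ≤ U.card := by exact_mod_cast this
    nlinarith
  · have hX : (degSum G X₀ : ℤ) ≤ (farFrom G U v).card + ((farFrom G U v).card + 2 - t) ^ 2 +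
        2 * ((farFrom G U v).card + 2 - t) := by
      rcases hcase with ⟨heq, h⟩ | ⟨hlt', h⟩
      · have := ih _ hlt X₀ hdom _ h rfl
        rw [heq] at this ⊢
        convert this using 1
        ring
      · have := ih _ hlt X₀ hdom _ h rfl
        have h2 : (X₀.card : ℤ) - (t - 1 - ((farFrom G U v).card - X₀.card)) =
          (farFrom G U v).card + 2 - t - 1 := by ring
        rw [h2] at this
        have h0 : (0:ℤ) ≤ degIn G (farFrom G U v) y := by positivity
        nlinarith
    rw [hdeg] at hX
    zify at hle hcard hΔ h1
    set Δ : ℤ := ((degIn G U v : ℕ) : ℤ)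
    set x : ℤ := ((farFrom G U v).card : ℤ)
    have h0 : (0:ℤ) ≤ degIn G (farFrom G U v) y := by positivity
    have hr0 : 0 ≤ x + 2 - t := h0.trans hr
    rw [hcard]
    have h2 : 0 ≤ (x + 2 - t) * (Δ - 2) := mul_nonneg hr0 (by linarith)
    nlinarith

end Size

/-! ### The case of an odd total domination number -/

section OddSize

open scoped Classical

variable {V : Type*} {G : SimpleGraph V}

/-- The graph on all of `V` whose edges are the pairs of distinct non-adjacent vertices of `N`. -/
def coGraph (G : SimpleGraph V) (N : Finset V) : SimpleGraph V where
  Adj a b := a ≠ b ∧ a ∈ N ∧ b ∈ N ∧ ¬ G.Adj a b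
  symm := ⟨fun _ _ h => ⟨h.1.symm, h.2.2.1, h.2.1, fun h' => h.2.2.2 h'.symm⟩⟩
  loopless := ⟨fun _ h => h.1 rfl⟩

lemma coGraph_adj {N : Finset V} {a b : V} :
    (coGraph G N).Adj a b ↔ a ≠ b ∧ a ∈ N ∧ b ∈ N ∧ ¬ G.Adj a b := Iff.rfl

lemma degSum_add_degSum_coGraph (N : Finset V) :
    degSum G N + degSum (coGraph G N) N = N.card * (N.card - 1) := by
  unfold degSum
  rw [← Finset.sum_add_distrib, ← smul_eq_mul, ← Finset.sum_const]
  refine Finset.sum_congr rfl fun u hu => ?_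
  rw [← Finset.card_erase_of_mem hu, degIn, degIn, ← Finset.card_union_of_disjoint]
  · congr 1
    ext w
    simp only [Finset.mem_union, Finset.mem_filter, Finset.mem_erase, coGraph_adj]
    constructor
    · rintro (h | h)
      exacts [⟨h.2.ne', h.1⟩, ⟨h.2.1.symm, h.1⟩]
    · rintro ⟨h1, h2⟩
      by_cases h : G.Adj u w
      exacts [Or.inl ⟨h2, h⟩, Or.inr ⟨h2, h1.symm, hu, h2, h⟩]
  · rw [Finset.disjoint_left]
    intro a h1 h2
    exact (Finset.mem_filter.1 h2).2.2.2.2 (Finset.mem_filter.1 h1).2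

lemma degSum_univ_eq [Fintype V] (F : SimpleGraph V) [Fintype F.edgeSet] :
    degSum F Finset.univ = 2 * F.edgeFinset.card := by
  have h : ∑ v, F.degree v = 2 * F.edgeFinset.card := by
    convert F.sum_degrees_eq_twice_card_edges
  rw [← h]
  refine Finset.sum_congr rfl fun u _ => ?_
  rw [degIn, ← F.card_neighborFinset_eq_degree]
  congr 1
  ext w
  simp

lemma degSum_coGraph_eq [Fintype V] (N : Finset V) :
    degSum (coGraph G N) N = 2 * (coGraph G N).edgeFinset.card := by
  rw [← degSum_univ_eq]
  unfold degSum
  have h : ∀ u, degIn (coGraph G N) N u = degIn (coGraph G N) Finset.univ u := by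
    intro u
    unfold degIn
    congr 1
    ext w
    simp only [Finset.mem_filter, Finset.mem_univ, true_and, coGraph_adj]
    tauto
  simp only [h]
  refine Finset.sum_subset (Finset.subset_univ _) fun u _ hu => ?_
  rw [degIn, Finset.card_eq_zero, Finset.filter_eq_empty_iff]
  exact fun w _ hw => hu hw.2.1

/-- Vertices lying in one connected component of `F` number at most one more than the edges
of `F`. -/
lemma card_le_card_edgeFinset_add_one [Fintype V] (F : SimpleGraph V) (Y : Finset V)
    (h : ∀ a ∈ Y, ∀ b ∈ Y, F.Reachable a b) : Y.card ≤ F.edgeFinset.card + 1 := by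
  rcases Y.eq_empty_or_nonempty with rfl | ⟨y, hy⟩
  · simp
  set K := F.connectedComponentMk y
  have h1 := K.connected_toSimpleGraph.card_vert_le_card_edgeSet_add_one
  have h2 : Y.card ≤ Nat.card K.supp := by
    rw [Nat.card_eq_fintype_card, Fintype.card_ofFinset]
    refine Finset.card_le_card fun a ha => ?_
    simp only [Finset.mem_filter, Finset.mem_univ, true_and]
    exact SimpleGraph.ConnectedComponent.eq.2 (h a ha y hy)
  have h3 : Nat.card K.toSimpleGraph.edgeSet ≤ Nat.card F.edgeSet := by
    refine Nat.card_le_card_of_injective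
      (SimpleGraph.Embedding.mapEdgeSet (SimpleGraph.Embedding.induce K.supp))
      (SimpleGraph.Embedding.mapEdgeSet _).injective
  rw [Nat.card_eq_fintype_card (α := F.edgeSet), ← SimpleGraph.edgeFinset_card] at h3
  exact h2.trans (h1.trans (by omega))

/-- The sharp estimate behind the odd case: if `|X| = t - 1` and every neighbour of `v` has at
most one neighbour in `X`, then the number of edges between `N(v)` and `X` exceeds the number of
non-adjacent pairs in `N(v)` by at most one. Neighbours of `v` attached to different vertices of `X`
have a common non-neighbour in `N(v)`, since otherwise they would start a small total dominating
set that does not use `v`. -/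
lemma two_mul_sum_degIn_le [Fintype V] {U : Finset V} (hU : Dominates G U U) {t : ℤ}
    (ht : ∀ T ⊆ U, Dominates G T U → t ≤ T.card) (hodd : Odd t) {v : V}
    (hcard : ((farFrom G U v).card : ℤ) = t - 1)
    (hone : ∀ y ∈ U.filter (G.Adj v), degIn G (farFrom G U v) y ≤ 1)
    (hX : Dominates G (farFrom G U v) (farFrom G U v) ∨
      degSum G (farFrom G U v) < (farFrom G U v).card) :
    2 * ∑ y ∈ U.filter (G.Adj v), degIn G (farFrom G U v) y ≤
      degSum (coGraph G (U.filter (G.Adj v))) (U.filter (G.Adj v)) + 2 := by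
  set X := farFrom G U v with hXdef
  set N := U.filter (G.Adj v) with hN
  set F := coGraph G N with hF
  have hXU : X ⊆ U := Finset.filter_subset _ _
  have hNU : N ⊆ U := Finset.filter_subset _ _
  set Y := N.filter fun y => ∃ x ∈ X, G.Adj y x with hY
  have hsum : ∑ y ∈ N, degIn G X y ≤ Y.card := by
    rw [hY, Finset.card_filter]
    refine Finset.sum_le_sum fun y hy => ?_
    split_ifs with h
    · exact hone y hy
    · rw [degIn, Nat.le_zero, Finset.card_eq_zero, Finset.filter_eq_empty_iff]
      exact fun x hx hxy => h ⟨x, hx, hxy⟩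
  rw [degSum_coGraph_eq]
  change _ ≤ 2 * F.edgeFinset.card + 2
  suffices h : Y.card ≤ F.edgeFinset.card + 1 by omega
  have hchoice : ∀ y ∈ Y, ∃ x ∈ X, G.Adj y x := fun y hy => (Finset.mem_filter.1 hy).2
  choose! f hfX hfadj using hchoice
  have huniq : ∀ y ∈ N, ∀ x ∈ X, ∀ x' ∈ X, G.Adj y x → G.Adj y x' → x = x' := by
    intro y hy x hx x' hx' h h'
    exact Finset.card_le_one.1 (hone y hy) x (Finset.mem_filter.2 ⟨hx, h⟩) x'
      (Finset.mem_filter.2 ⟨hx', h'⟩)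
  have hYN : ∀ y ∈ Y, y ∈ N := fun y hy => (Finset.mem_filter.1 hy).1
  have hvN : ∀ y ∈ N, G.Adj v y := fun y hy => (Finset.mem_filter.1 hy).2
  have hsplit : ∀ u ∈ U, u = v ∨ u ∈ N ∨ u ∈ X := by
    intro u hu
    by_cases h1 : u = v
    · exact Or.inl h1
    by_cases h2 : G.Adj v u
    · exact Or.inr (Or.inl (Finset.mem_filter.2 ⟨hu, h2⟩))
    · exact Or.inr (Or.inr (mem_farFrom.2 ⟨hu, h1, h2⟩))
  have hreach : ∀ a ∈ Y, ∀ b ∈ Y, f a ≠ f b → F.Reachable a b := by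
    intro a ha b hb hab
    have hex : ∃ c ∈ N, ¬ G.Adj c a ∧ ¬ G.Adj c b := by
      by_contra hcon
      push Not at hcon
      have h := le_card_add_card hU ht (S := {a, b}) (Z := (X.erase (f a)).erase (f b))
        (by simp [Finset.insert_subset_iff, hNU (hYN a ha), hNU (hYN b hb)]) (by
        intro u hu
        rcases hsplit u hu with rfl | h | h
        · exact Or.inr ⟨a, by simp, hvN a (hYN a ha)⟩
        · by_cases h1 : G.Adj u a
          · exact Or.inr ⟨a, by simp, h1⟩
          · exact Or.inr ⟨b, by simp, hcon u h h1⟩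
        · by_cases h1 : u = f a
          · exact Or.inr ⟨a, by simp, h1 ▸ (hfadj a ha).symm⟩
          by_cases h2 : u = f b
          · exact Or.inr ⟨b, by simp, h2 ▸ (hfadj b hb).symm⟩
          · left; simp [h1, h2, h])
      have h1 : ({a, b} : Finset V).card ≤ 2 := Finset.card_le_two
      have h2 : f b ∈ X.erase (f a) := Finset.mem_erase.2 ⟨hab.symm, hfX b hb⟩
      have h3 := Finset.card_erase_add_one h2
      have h4 := Finset.card_erase_add_one (hfX a ha)
      omega
    obtain ⟨c, hc, hca, hcb⟩ := hex
    have key : ∀ d ∈ N, ¬ G.Adj c d → F.Reachable c d := by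
      intro d hd h
      by_cases he : c = d
      · rw [he]
      · exact SimpleGraph.Adj.reachable (coGraph_adj.2 ⟨he, hc, hd, h⟩)
    exact (key a (hYN a ha) hca).symm.trans (key b (hYN b hb) hcb)
  by_cases hclass : ∃ a ∈ Y, ∃ b ∈ Y, f a ≠ f b
  · obtain ⟨a, ha, b, hb, hab⟩ := hclass
    refine card_le_card_edgeFinset_add_one F Y fun c hc d hd => ?_
    have key : ∀ c ∈ Y, F.Reachable c a := by
      intro c hc
      by_cases h1 : f c = f a
      · exact (hreach c hc b hb (h1 ▸ hab)).trans (hreach b hb a ha hab.symm)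
      · exact hreach c hc a ha h1
    exact (key c hc).trans (key d hd).symm
  push Not at hclass
  rcases Y.eq_empty_or_nonempty with he | ⟨y₀, hy₀⟩
  · simp [he]
  -- All vertices of `Y` are attached to the same vertex `a` of `X`.
  set a := f y₀ with ha
  have haX : a ∈ X := hfX y₀ hy₀
  have hYa : ∀ y ∈ Y, G.Adj y a := fun y hy => by
    rw [ha, hclass y₀ hy₀ y hy]; exact hfadj y hy
  have hb : ∃ b ∈ X, G.Adj a b := by
    rcases hX with hX | hX
    · exact hX a haX
    -- If `a` were isolated in `X`, the degree sum in `X` would be the odd number `|X| - 1`.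
    by_contra hcon
    have h1 : ∀ x ∈ X.erase a, 1 ≤ degIn G X x := by
      intro x hx
      obtain ⟨hxa, hxX⟩ := Finset.mem_erase.1 hx
      obtain ⟨w, hw, hxw⟩ := hU x (hXU hxX)
      rcases hsplit w hw with rfl | h | h
      · exact absurd hxw.symm (mem_farFrom.1 hxX).2.2
      · have hwY : w ∈ Y := Finset.mem_filter.2 ⟨h, x, hxX, hxw.symm⟩
        exact absurd (huniq w h x hxX a haX hxw.symm (hYa w hwY)) hxa
      · exact Finset.card_pos.2 ⟨w, Finset.mem_filter.2 ⟨h, hxw⟩⟩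
    have h2 := Finset.sum_le_sum h1
    rw [← Finset.card_eq_sum_ones] at h2
    have h3 : ∑ x ∈ X.erase a, degIn G X x ≤ degSum G X :=
      Finset.sum_le_sum_of_subset (Finset.erase_subset _ _)
    have h4 := Finset.card_erase_add_one haX
    obtain ⟨m, hm⟩ := even_degSum (G := G) X
    obtain ⟨l, hl⟩ := hodd
    omega
  obtain ⟨b, hbX, hab⟩ := hb
  have hout : ∀ y ∈ Y, ∃ c, c ∉ Y ∧ F.Adj y c := by
    intro y hy
    have hex : ∃ c ∈ N, ¬ G.Adj c y ∧ ¬ G.Adj c a := by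
      by_contra hcon
      push Not at hcon
      have h := le_card_add_card hU ht (S := {y, a}) (Z := (X.erase a).erase b)
        (by simp [Finset.insert_subset_iff, hNU (hYN y hy), hXU haX]) (by
        intro u hu
        rcases hsplit u hu with rfl | h | h
        · exact Or.inr ⟨y, by simp, hvN y (hYN y hy)⟩
        · by_cases h1 : G.Adj u y
          · exact Or.inr ⟨y, by simp, h1⟩
          · exact Or.inr ⟨a, by simp, hcon u h h1⟩
        · by_cases h1 : u = a
          · exact Or.inr ⟨y, by simp, h1 ▸ (hYa y hy).symm⟩
          by_cases h2 : u = b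
          · exact Or.inr ⟨a, by simp, h2 ▸ hab.symm⟩
          · left; simp [h1, h2, h])
      have h1 : ({y, a} : Finset V).card ≤ 2 := Finset.card_le_two
      have h2 : b ∈ X.erase a := Finset.mem_erase.2 ⟨hab.ne', hbX⟩
      have h3 := Finset.card_erase_add_one h2
      have h4 := Finset.card_erase_add_one haX
      omega
    obtain ⟨c, hc, hcy, hca⟩ := hex
    refine ⟨c, fun h => hca (hYa c h), coGraph_adj.2 ⟨?_, hYN y hy, hc, fun h => hcy h.symm⟩⟩
    rintro rfl
    exact hca (hYa y hy)
  choose! g hgY hgadj using hout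
  refine le_trans (Finset.card_le_card_of_injOn (fun y => s(y, g y)) ?_ ?_) (Nat.le_succ _)
  · intro y hy
    simpa using hgadj y hy
  · intro y hy y' hy' h
    rcases Sym2.eq_iff.1 h with h | h
    · exact h.1
    · exact absurd (h.1 ▸ hy : g y' ∈ Y) (hgY y' hy')

/-- If some neighbour `y` of `v` has the largest possible number `r = |X| + 2 - t` of neighbours
in `X`, then no vertex dominates two of the other vertices of `X`, so `X` spans few edges. -/
lemma degSum_farFrom_le {U : Finset V} (hU : Dominates G U U) {t : ℤ}
    (ht : ∀ T ⊆ U, Dominates G T U → t ≤ T.card) {v y : V} (hv : v ∈ U)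
    (hy : y ∈ U.filter (G.Adj v))
    (heq : (degIn G (farFrom G U v) y : ℤ) = (farFrom G U v).card + 2 - t) :
    (degSum G (farFrom G U v) : ℤ) ≤
      (farFrom G U v).card + ((farFrom G U v).card + 2 - t) ^ 2 := by
  set X := farFrom G U v with hX
  have hXU : X ⊆ U := Finset.filter_subset _ _
  rw [Finset.mem_filter] at hy
  set R := X.filter (G.Adj y) with hR
  set Z := X.filter (¬ G.Adj y ·) with hZ
  have hRZ : Disjoint R Z := Finset.disjoint_filter_filter_not _ _ _
  have hXRZ : X = R ∪ Z := (Finset.filter_union_filter_not_eq _ _).symm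
  have hcard : R.card + Z.card = X.card :=
    Finset.card_filter_add_card_filter_not (s := X) (G.Adj y)
  have hRc : (R.card : ℤ) = X.card + 2 - t := heq
  have hone : ∀ u ∈ X, degIn G Z u ≤ 1 := by
    intro u hu
    refine Finset.card_le_one.2 fun z₁ h₁ z₂ h₂ => ?_
    by_contra hne
    rw [Finset.mem_filter] at h₁ h₂
    have h := le_card_add_card hU ht (S := {v, y, u}) (Z := (Z.erase z₁).erase z₂)
      (by simp [Finset.insert_subset_iff, hv, hy.1, hXU hu]) (by
      intro w hw
      by_cases h1 : w = v
      · exact Or.inr ⟨y, by simp, h1 ▸ hy.2⟩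
      by_cases h2 : G.Adj v w
      · exact Or.inr ⟨v, by simp, h2.symm⟩
      by_cases h3 : G.Adj y w
      · exact Or.inr ⟨y, by simp, h3.symm⟩
      by_cases h4 : w = z₁
      · exact Or.inr ⟨u, by simp, h4 ▸ h₁.2.symm⟩
      by_cases h5 : w = z₂
      · exact Or.inr ⟨u, by simp, h5 ▸ h₂.2.symm⟩
      · left
        simp only [Finset.mem_erase]
        exact ⟨h5, h4, Finset.mem_filter.2 ⟨mem_farFrom.2 ⟨hw, h1, h2⟩, h3⟩⟩)
    have h1 : ({v, y, u} : Finset V).card ≤ 3 := Finset.card_le_three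
    have h2 := Finset.card_erase_add_one (Finset.mem_erase.2 ⟨Ne.symm hne, h₂.1⟩)
    have h3 := Finset.card_erase_add_one h₁.1
    omega
  have hdeg := degSum_union (G := G) hRZ
  rw [← hXRZ] at hdeg
  have hZZ : ∑ u ∈ X, degIn G Z u ≤ X.card := by
    rw [Finset.card_eq_sum_ones]
    exact Finset.sum_le_sum hone
  have hRZsum : ∑ u ∈ R, degIn G Z u ≤ R.card := by
    rw [Finset.card_eq_sum_ones]
    exact Finset.sum_le_sum fun u hu => hone u (Finset.filter_subset _ _ hu)
  have hsplit : ∑ u ∈ X, degIn G Z u = ∑ u ∈ R, degIn G Z u + degSum G Z := by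
    conv_lhs => rw [hXRZ]
    rw [Finset.sum_union hRZ, degSum]
  have hRR := degSum_le (G := G) R
  rw [← hRc]
  zify at hdeg hZZ hRZsum hsplit
  nlinarith

/-- A graph on `n` vertices whose total dominating sets have at least `t = n - p` elements, with
`t` odd, is a perfect matching if `p ≤ 1` and has at most `(n + p² + 1) / 2` edges otherwise. -/
theorem degSum_le_of_le_card_of_odd [Fintype V] (U : Finset V) (hU : Dominates G U U) (t : ℤ)
    (hodd : Odd t) (ht : ∀ T ⊆ U, Dominates G T U → t ≤ T.card) :
    ((U.card : ℤ) - t ≤ 1 → (degSum G U : ℤ) ≤ U.card) ∧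
      (2 ≤ (U.card : ℤ) - t → (degSum G U : ℤ) ≤ U.card + (U.card - t) ^ 2 + 1) := by
  induction hn : U.card using Nat.strong_induction_on generalizing U t with
  | _ n ih =>
  subst hn
  have htU := ht U subset_rfl hU
  rcases U.eq_empty_or_nonempty with rfl | hne
  · simp only [degSum, Finset.sum_empty, Nat.cast_zero, Finset.card_empty]
    exact ⟨fun _ => le_rfl, fun _ => by positivity⟩
  obtain ⟨v, hv, hmax⟩ := Finset.exists_max_image U (degIn G U) hne
  obtain ⟨y, hy, hvy⟩ := hU v hv
  have hyN : y ∈ U.filter (G.Adj v) := Finset.mem_filter.2 ⟨hy, hvy⟩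
  have hΔ : 1 ≤ degIn G U v := Finset.card_pos.2 ⟨y, hyN⟩
  have hcard := card_eq_farFrom (G := G) hv
  have hr := degIn_farFrom_le hU ht hv hyN
  have hle := degSum_le_farFrom hv hmax
  obtain ⟨X₀, hsub, hdom, hdeg, hcase⟩ := exists_residual hU ht hv
  have hX₀ : X₀.card ≤ (farFrom G U v).card := Finset.card_le_card hsub
  have hlt : X₀.card < U.card := by omega
  rcases hΔ.eq_or_lt with h1 | h1
  · have : degSum G U ≤ ∑ u ∈ U, 1 := Finset.sum_le_sum fun u hu => by
      rw [h1]; exact hmax u hu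
    rw [Finset.sum_const, smul_eq_mul, mul_one] at this
    have h3 : (degSum G U : ℤ) ≤ U.card := by exact_mod_cast this
    exact ⟨fun _ => h3, fun _ => by nlinarith⟩
  have hr0 : 0 ≤ ((farFrom G U v).card : ℤ) + 2 - t := le_trans (by positivity) hr
  rcases hr0.eq_or_lt with hr1 | hr1
  · -- Here `X` would be a perfect matching on the odd number `t - 2` of vertices.
    exfalso
    rcases hcase with ⟨heq, h⟩ | ⟨-, h⟩
    · have h2 := degSum_le_of_le_card X₀ hdom _ h
      have h3 := card_le_degSum hdom
      have h4 : (X₀.card : ℤ) - (t - 2) = 0 := by rw [heq]; linarith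
      rw [h4] at h2
      obtain ⟨m, hm⟩ := even_degSum (G := G) X₀
      obtain ⟨l, hl⟩ := hodd
      omega
    · have := h X₀ subset_rfl hdom
      linarith
  have hodd2 : Odd (t - 2) := by
    obtain ⟨l, hl⟩ := hodd
    exact ⟨l - 1, by linarith⟩
  refine ⟨fun h => by omega, fun _ => ?_⟩
  rcases (show (1 : ℤ) ≤ (farFrom G U v).card + 2 - t from hr1).eq_or_lt with hr2 | hr2
  · have hXcard : ((farFrom G U v).card : ℤ) = t - 1 := by linarith
    have hXle : degSum G (farFrom G U v) ≤ (farFrom G U v).card ∧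
        (Dominates G (farFrom G U v) (farFrom G U v) ∨
          degSum G (farFrom G U v) < (farFrom G U v).card) := by
      rcases hcase with ⟨heq, h⟩ | ⟨hlt', h⟩
      · rw [heq] at h hdom hlt
        have := (ih _ hlt _ hdom _ hodd2 h rfl).1 (by linarith)
        exact ⟨by exact_mod_cast this, Or.inl hdom⟩
      · have := degSum_le_of_le_card X₀ hdom _ h
        have h4 : (X₀.card : ℤ) - (t - 1 - ((farFrom G U v).card - X₀.card)) = 0 := by linarith
        rw [h4] at this
        have h5 : degSum G X₀ ≤ X₀.card := by
          have : (degSum G X₀ : ℤ) ≤ X₀.card := by linarith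
          exact_mod_cast this
        omega
    have h2 := two_mul_sum_degIn_le hU ht hodd hXcard (fun y hy => by
      have := degIn_farFrom_le hU ht hv hy
      omega) hXle.2
    have h3 := degSum_add_degSum_coGraph (G := G) (U.filter (G.Adj v))
    have h4 := degSum_eq_farFrom (G := G) hv
    change _ = degIn G U v * (degIn G U v - 1) at h3
    have h5 : (U.card : ℤ) - t = degIn G U v := by rw [hcard]; push_cast; linarith
    rw [h5]
    have h6 : degIn G U v * (degIn G U v - 1) + degIn G U v = degIn G U v ^ 2 := by
      obtain ⟨m, hm⟩ := Nat.exists_eq_add_of_lt h1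
      rw [hm]
      simp only [Nat.add_sub_cancel]
      ring
    have h7 : degSum G U ≤ U.card + degIn G U v ^ 2 + 1 := by omega
    exact_mod_cast h7
  · have hX : (degSum G (farFrom G U v) : ℤ) ≤
          (farFrom G U v).card + ((farFrom G U v).card + 2 - t) ^ 2 - 1 ∨
        (degSum G (farFrom G U v) : ℤ) ≤
          (farFrom G U v).card + ((farFrom G U v).card + 2 - t) ^ 2 + 1 ∧
          ∀ y ∈ U.filter (G.Adj v), (degIn G (farFrom G U v) y : ℤ) ≤
            (farFrom G U v).card + 2 - t - 1 := by
      rcases hcase with ⟨heq, h⟩ | ⟨hlt', h⟩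
      · by_cases hex : ∃ y ∈ U.filter (G.Adj v),
            (degIn G (farFrom G U v) y : ℤ) = (farFrom G U v).card + 2 - t
        · obtain ⟨y, hy, hyr⟩ := hex
          have h2 := degSum_farFrom_le hU ht hv hy hyr
          left
          obtain ⟨m, hm⟩ := even_degSum (G := G) (farFrom G U v)
          obtain ⟨l, hl⟩ := hodd
          -- The bound has the wrong parity to be attained.
          have hpar : Odd (((farFrom G U v).card : ℤ) + ((farFrom G U v).card + 2 - t) ^ 2) := by
            have h3 := Int.even_mul_succ_self (((farFrom G U v).card : ℤ) + 2 - t)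
            obtain ⟨j, hj⟩ := h3
            exact ⟨j + l - 1, by nlinarith⟩
          obtain ⟨j, hj⟩ := hpar
          rw [hj] at h2 ⊢
          omega
        · push Not at hex
          right
          rw [heq] at h hdom hlt
          have h2 := (ih _ hlt _ hdom _ hodd2 h rfl).2 (by linarith)
          refine ⟨by convert h2 using 3; ring, fun y hy => ?_⟩
          have := degIn_farFrom_le hU ht hv hy
          have := hex y hy
          omega
      · left
        have h2 := degSum_le_of_le_card X₀ hdom _ h
        rw [hdeg] at h2
        have h4 : (X₀.card : ℤ) - (t - 1 - ((farFrom G U v).card - X₀.card)) =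
          (farFrom G U v).card + 2 - t - 1 := by ring
        rw [h4] at h2
        have h5 : (X₀.card : ℤ) + 1 ≤ (farFrom G U v).card := by exact_mod_cast hlt'
        nlinarith
    have hsum : ∀ b : ℤ, (∀ y ∈ U.filter (G.Adj v), (degIn G (farFrom G U v) y : ℤ) ≤ b) →
        (∑ y ∈ U.filter (G.Adj v), (degIn G (farFrom G U v) y : ℤ)) ≤ degIn G U v * b := by
      intro b hb
      have := Finset.sum_le_card_nsmul _ _ _ hb
      rwa [nsmul_eq_mul] at this
    zify at hle hcard h1
    have h3 : 0 ≤ (((farFrom G U v).card : ℤ) + 2 - t - 2) * ((degIn G U v : ℤ) - 2) :=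
      mul_nonneg (by linarith) (by linarith)
    rw [hcard]
    rcases hX with hX | ⟨hX, hc⟩
    · have hc := hsum _ fun y hy => degIn_farFrom_le hU ht hv hy
      nlinarith
    · have hc := hsum _ hc
      nlinarith

end OddSize

/-! ### Matchings and active components -/

section Matching

open scoped Classical

variable {V : Type*} {G G' : SimpleGraph V}

/-- A matching of `G`, encoded as the involution that exchanges the ends of every matching edge and
fixes the unmatched vertices. Its support has twice as many elements as the matching has edges. -/
structure IsMatchingPerm (G : SimpleGraph V) (m : Equiv.Perm V) : Prop where
  inv : ∀ v, m (m v) = v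
  adj : ∀ v, m v ≠ v → G.Adj v (m v)

lemma IsMatchingPerm.mono {m : Equiv.Perm V} (hm : IsMatchingPerm G m) (h : G ≤ G') :
    IsMatchingPerm G' m :=
  ⟨hm.inv, fun v hv => h (hm.adj v hv)⟩

lemma IsMatchingPerm.ne {m : Equiv.Perm V} (hm : IsMatchingPerm G m) {v : V} (hv : m v ≠ v) :
    m (m v) ≠ m v := by
  rw [hm.inv]; exact hv.symm

variable [Fintype V]

/-- If `z` is unmatched and `w` is matched, then `w` can be matched to `z` instead. -/
lemma exists_rematch {m : Equiv.Perm V} (hm : ∀ v, m (m v) = v) {w z : V} (hz : m z = z)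
    (hw : m w ≠ w) : ∃ m' : Equiv.Perm V, (∀ v, m' (m' v) = v) ∧ m' w = z ∧ m' z = w ∧
      m' (m w) = m w ∧ (∀ v, v ≠ w → v ≠ z → v ≠ m w → m' v = m v) ∧
      m'.support.card = m.support.card := by
  have hzw : z ≠ w := by rintro rfl; exact hw hz
  have hzw' : z ≠ m w := by
    intro h
    have := hm w
    rw [← h, hz] at this
    exact hzw this
  refine ⟨Equiv.swap (m w) z * m * (Equiv.swap (m w) z)⁻¹, ?_, ?_, ?_, ?_, ?_, ?_⟩
  · intro v
    simp [Equiv.Perm.mul_apply, hm]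
  · simp [Equiv.Perm.mul_apply, Equiv.swap_apply_of_ne_of_ne hw.symm hzw.symm]
  · simp [Equiv.Perm.mul_apply, hm, Equiv.swap_apply_of_ne_of_ne hw.symm hzw.symm]
  · simp [Equiv.Perm.mul_apply, hz]
  · intro v h1 h2 h3
    have h4 : m v ≠ m w := fun h => h1 (m.injective h)
    have h5 : m v ≠ z := fun h => h2 (by rw [← hm v, h, hz])
    simp [Equiv.Perm.mul_apply, Equiv.swap_apply_of_ne_of_ne h3 h2,
      Equiv.swap_apply_of_ne_of_ne h4 h5]
  · exact Equiv.Perm.card_support_conj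

/-- A matching of maximum size leaves no two adjacent vertices unmatched. -/
lemma exists_lt_of_unmatched {m : Equiv.Perm V} (hm : IsMatchingPerm G m) {w z : V}
    (hwz : G.Adj w z) (hw : m w = w) (hz : m z = z) :
    ∃ m' : Equiv.Perm V, IsMatchingPerm G m' ∧ m.support.card < m'.support.card := by
  have hd : m.Disjoint (Equiv.swap w z) := by
    intro v
    by_cases h1 : v = w
    · exact Or.inl (h1 ▸ hw)
    by_cases h2 : v = z
    · exact Or.inl (h2 ▸ hz)
    · exact Or.inr (Equiv.swap_apply_of_ne_of_ne h1 h2)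
  refine ⟨m * Equiv.swap w z, ⟨fun v => ?_, fun v hv => ?_⟩, ?_⟩
  · have h := hd.commute.eq
    rw [← Equiv.Perm.mul_apply]
    have : m * Equiv.swap w z * (m * Equiv.swap w z) = 1 := by
      calc _ = m * (Equiv.swap w z * m) * Equiv.swap w z := by simp [mul_assoc]
        _ = m * m * (Equiv.swap w z * Equiv.swap w z) := by rw [← h]; simp [mul_assoc]
        _ = 1 := by
          rw [Equiv.swap_mul_self, mul_one]
          exact Equiv.ext hm.inv
    rw [this]; rfl
  · rw [Equiv.Perm.mul_apply] at hv ⊢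
    by_cases h1 : v = w
    · subst h1; rw [Equiv.swap_apply_left, hz]; exact hwz
    by_cases h2 : v = z
    · subst h2; rw [Equiv.swap_apply_right, hw]; exact hwz.symm
    · rw [Equiv.swap_apply_of_ne_of_ne h1 h2] at hv ⊢
      exact hm.adj v hv
  · rw [hd.card_support_mul, Equiv.Perm.card_support_swap hwz.ne]
    omega

lemma exists_max_matching (G : SimpleGraph V) : ∃ m : Equiv.Perm V, IsMatchingPerm G m ∧
    ∀ m' : Equiv.Perm V, IsMatchingPerm G m' → m'.support.card ≤ m.support.card := by
  have hne : (Finset.univ.filter fun m : Equiv.Perm V => IsMatchingPerm G m).Nonempty :=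
    ⟨1, by simpa using ⟨fun _ => rfl, fun v hv => absurd rfl hv⟩⟩
  obtain ⟨m, hm, hmax⟩ := Finset.exists_max_image _ (fun m => m.support.card) hne
  exact ⟨m, (Finset.mem_filter.1 hm).2, fun m' hm' => hmax m' (by simpa using hm')⟩

/-- The ends of the edges of a maximum matching form a total dominating set. -/
lemma isTotalDominatingSet_support (hG : ∀ v, ∃ w, G.Adj v w) {m : Equiv.Perm V}
    (hm : IsMatchingPerm G m)
    (hmax : ∀ m' : Equiv.Perm V, IsMatchingPerm G m' → m'.support.card ≤ m.support.card) :
    IsTotalDominatingSet G m.support := by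
  intro v
  by_cases hv : m v = v
  · obtain ⟨w, hw⟩ := hG v
    refine ⟨w, Equiv.Perm.mem_support.2 fun h => ?_, hw⟩
    obtain ⟨m', hm', hlt⟩ := exists_lt_of_unmatched hm hw hv h
    exact absurd (hmax m' hm') (by omega)
  · exact ⟨m v, Equiv.Perm.mem_support.2 (hm.ne hv), hm.adj v hv⟩

end Matching

section Active

open scoped Classical

variable {V : Type*} {G G' : SimpleGraph V}

/-- The vertices `a, b, c` form a connected component of `G` that is a triangle. -/
def IsTriangleComponent (G : SimpleGraph V) (a b c : V) : Prop :=
  (∀ d, G.Adj a d ↔ d = b ∨ d = c) ∧ (∀ d, G.Adj b d ↔ d = a ∨ d = c) ∧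
    ∀ d, G.Adj c d ↔ d = a ∨ d = b

/-- An edge neither end of which is a leaf and which does not lie in a triangle component. The
components without such edges are the stars and the triangles. -/
structure IsActiveEdge (G : SimpleGraph V) (a b : V) : Prop where
  adj : G.Adj a b
  left : ∃ c, c ≠ b ∧ G.Adj a c
  right : ∃ c, c ≠ a ∧ G.Adj b c
  not_triangle : ∀ c, ¬ IsTriangleComponent G a b c

lemma IsActiveEdge.mono {a b : V} (h : IsActiveEdge G' a b) (hle : G' ≤ G) :
    IsActiveEdge G a b := by
  obtain ⟨hab, ⟨c, hcb, hac⟩, ⟨d, hda, hbd⟩, ht⟩ := h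
  refine ⟨hle hab, ⟨c, hcb, hle hac⟩, ⟨d, hda, hle hbd⟩, fun e he => ht e ?_⟩
  obtain ⟨h1, h2, h3⟩ := he
  have hc : c = e := ((h1 c).1 (hle hac)).resolve_left hcb
  have hd : d = e := ((h2 d).1 (hle hbd)).resolve_left hda
  subst hc hd
  refine ⟨fun x => ⟨fun h => (h1 x).1 (hle h), ?_⟩, fun x => ⟨fun h => (h2 x).1 (hle h), ?_⟩,
    fun x => ⟨fun h => (h3 x).1 (hle h), ?_⟩⟩
  · rintro (rfl | rfl); exacts [hab, hac]
  · rintro (rfl | rfl); exacts [hab.symm, hbd]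
  · rintro (rfl | rfl); exacts [hac.symm, hbd.symm]

variable [Fintype V]

/-- The vertices of the components of `G` that contain an active edge, that is, of the components
that are neither stars nor triangles. -/
noncomputable def active (G : SimpleGraph V) : Finset V :=
  Finset.univ.filter fun v => ∃ a b, G.Reachable v a ∧ IsActiveEdge G a b

lemma mem_active {v : V} : v ∈ active G ↔ ∃ a b, G.Reachable v a ∧ IsActiveEdge G a b := by
  simp [active]

lemma active_closed {v u : V} (hv : v ∈ active G) (h : G.Adj v u) : u ∈ active G := by
  obtain ⟨a, b, hr, hab⟩ := mem_active.1 hv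
  exact mem_active.2 ⟨a, b, h.symm.reachable.trans hr, hab⟩

lemma active_mono (hle : G' ≤ G) : active G' ⊆ active G := by
  intro v hv
  obtain ⟨a, b, hr, hab⟩ := mem_active.1 hv
  exact mem_active.2 ⟨a, b, hr.mono hle, hab.mono hle⟩

lemma notMem_active_of_closed (T : Set V) (hT : ∀ a ∈ T, ∀ b, G.Adj a b → b ∈ T)
    (hact : ∀ a ∈ T, ∀ b, ¬ IsActiveEdge G a b) {v : V} (hv : v ∈ T) : v ∉ active G := by
  intro h
  obtain ⟨a, b, ⟨p⟩, hab⟩ := mem_active.1 h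
  suffices ha : a ∈ T from hact a ha b hab
  induction p with
  | nil => exact hv
  | cons hadj p ih =>
    exact ih (hT _ hv _ hadj) (active_closed h hadj) hab

/-- A vertex all of whose neighbours are leaves, and such a leaf itself, is not active. -/
lemma notMem_active_of_star {x : V} (h : ∀ p, G.Adj x p → ∀ c, G.Adj p c → c = x) :
    x ∉ active G ∧ ∀ p, G.Adj x p → p ∉ active G := by
  have key : ∀ v, v = x ∨ G.Adj x v → v ∉ active G := by
    intro v hv
    refine notMem_active_of_closed {v | v = x ∨ G.Adj x v} ?_ ?_ hv
    · rintro a (rfl | ha) b hab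
      · exact Or.inr hab
      · exact Or.inl (h a ha b hab)
    · rintro a (rfl | ha) b hab
      · obtain ⟨c, hc, hbc⟩ := hab.right
        exact hc (h b hab.adj c hbc)
      · obtain ⟨c, hc, hac⟩ := hab.left
        exact hc ((h a ha c hac).trans (h a ha b hab.adj).symm)
  exact ⟨key x (Or.inl rfl), fun p hp => key p (Or.inr hp)⟩

lemma trichotomy_of_not_isActiveEdge {a b : V} (hadj : G.Adj a b) (h : ¬ IsActiveEdge G a b) :
    (∀ c, G.Adj a c → c = b) ∨ (∀ c, G.Adj b c → c = a) ∨ ∃ c, IsTriangleComponent G a b c := by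
  by_contra hcon
  push Not at hcon
  obtain ⟨⟨c, h1, h2⟩, ⟨d, h3, h4⟩, h5⟩ := hcon
  exact h ⟨hadj, ⟨c, h2, h1⟩, ⟨d, h4, h3⟩, h5⟩

/-- In a graph whose components are stars and triangles, a total dominating set has at least twice
as many elements as any matching: it contains two vertices of every component, and a matching
at most one edge. -/
lemma card_support_le_of_inactive (hG : ∀ a b, ¬ IsActiveEdge G a b) {m : Equiv.Perm V}
    (hm : IsMatchingPerm G m) {S : Finset V} (hS : IsTotalDominatingSet G S) :
    m.support.card ≤ S.card := by
  choose d hdS hd using hS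
  -- A matched vertex is sent to itself if it is in `S`, else to a dominator of its partner.
  have hmix : ∀ x₁ x₂, m x₁ ≠ x₁ → m x₂ ≠ x₂ → x₁ ∈ S → x₂ ∉ S → x₁ ≠ d (m x₂) := by
    intro x₁ x₂ h₁ h₂ hx₁ hx₂ h
    have ha : G.Adj (m x₂) x₁ := h ▸ hd (m x₂)
    have ha₂ := (hm.adj x₂ h₂).symm
    have hne : x₂ ≠ x₁ := fun h => hx₂ (h ▸ hx₁)
    rcases trichotomy_of_not_isActiveEdge ha (hG _ _) with h | h | ⟨c, hc⟩
    · exact hne (h x₂ ha₂)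
    · exact hne (m.injective (h _ (hm.adj x₁ h₁))).symm
    · have hx₂c : x₂ = c := ((hc.1 x₂).1 ha₂).resolve_left hne
      rcases (hc.2.1 _).1 (hm.adj x₁ h₁) with h | h
      · exact hne (m.injective h).symm
      · rw [← hx₂c] at h
        rw [← h, hm.inv] at ha
        exact ha.ne rfl
  refine Finset.card_le_card_of_injOn (fun x => if x ∈ S then x else d (m x)) ?_ ?_
  · intro x _
    dsimp only
    split_ifs with h
    exacts [h, hdS _]
  · intro x₁ h₁ x₂ h₂ h
    have h₁ := Equiv.Perm.mem_support.1 h₁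
    have h₂ := Equiv.Perm.mem_support.1 h₂
    dsimp only at h
    split_ifs at h with hx₁ hx₂ hx₂
    · exact h
    · exact absurd h (hmix x₁ x₂ h₁ h₂ hx₁ hx₂)
    · exact absurd h.symm (hmix x₂ x₁ h₂ h₁ hx₂ hx₁)
    · have ha₁ := hd (m x₁)
      have ha₂ : G.Adj (m x₂) (d (m x₁)) := h ▸ hd (m x₂)
      have hs := hdS (m x₁)
      have hm₁ := (hm.adj x₁ h₁).symm
      have hne : x₁ ≠ d (m x₁) := fun h => hx₁ (h ▸ hs)
      rcases trichotomy_of_not_isActiveEdge ha₁ (hG _ _) with h' | h' | ⟨c, hc⟩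
      · exact absurd (h' _ hm₁) hne
      · exact (m.injective (h' _ ha₂.symm)).symm
      · have hxc : x₁ = c := ((hc.1 _).1 hm₁).resolve_left hne
        rcases (hc.2.1 _).1 ha₂.symm with h'' | h''
        · exact (m.injective h'').symm
        · -- The third vertex of the triangle would be the only one in `S`.
          exfalso
          rw [← hxc] at h''
          rcases (hc.2.1 _).1 (hd (d (m x₁))) with h3 | h3
          · apply hx₂
            rw [← h'', hm.inv] at h3
            exact h3 ▸ hdS _
          · rw [← hxc] at h3
            exact hx₁ (h3 ▸ hdS _)

end Active

/-! ### Splitting off a star -/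

section Steps

open scoped Classical

variable {V : Type*} {G G' G'' : SimpleGraph V}

/-- `G'` arises from `G` by deleting at most `cost` edges without isolating a vertex, and every
total dominating set of `G'` yields one of `G` with at least `gain` fewer elements. -/
structure IsStep (G G' : SimpleGraph V) (cost gain : ℕ) : Prop where
  le : G' ≤ G
  exists_adj : ∀ v, ∃ w, G'.Adj v w
  cost_le : ∃ D : Finset (Sym2 V), D.card ≤ cost ∧
    ∀ a b, G.Adj a b → ¬ G'.Adj a b → s(a, b) ∈ D
  gain_le : ∀ S', IsTotalDominatingSet G' S' →
    ∃ S, IsTotalDominatingSet G S ∧ S.card + gain ≤ S'.card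

lemma IsStep.refl (hG : ∀ v, ∃ w, G.Adj v w) : IsStep G G 0 0 :=
  ⟨le_rfl, hG, ⟨∅, by simp, fun _ _ h h' => absurd h h'⟩, fun S' hS' => ⟨S', hS', by simp⟩⟩

lemma IsStep.trans {c₁ c₂ g₁ g₂ : ℕ} (h₁ : IsStep G G' c₁ g₁) (h₂ : IsStep G' G'' c₂ g₂) :
    IsStep G G'' (c₁ + c₂) (g₁ + g₂) := by
  refine ⟨h₂.le.trans h₁.le, h₂.exists_adj, ?_, fun S'' hS'' => ?_⟩
  · obtain ⟨D₁, hD₁, h₁'⟩ := h₁.cost_le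
    obtain ⟨D₂, hD₂, h₂'⟩ := h₂.cost_le
    refine ⟨D₁ ∪ D₂, (Finset.card_union_le _ _).trans (by omega), fun a b h h' => ?_⟩
    by_cases hab : G'.Adj a b
    · exact Finset.mem_union_right _ (h₂' a b hab h')
    · exact Finset.mem_union_left _ (h₁' a b h hab)
  · obtain ⟨S', hS', h'⟩ := h₂.gain_le S'' hS''
    obtain ⟨S, hS, h⟩ := h₁.gain_le S' hS'
    exact ⟨S, hS, by omega⟩

/-- Remove from `G` the edges `ab` for which `R a b` or `R b a` holds. -/
def prune (G : SimpleGraph V) (R : V → V → Prop) : SimpleGraph V where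
  Adj a b := G.Adj a b ∧ ¬ R a b ∧ ¬ R b a
  symm := ⟨fun _ _ h => ⟨h.1.symm, h.2.2, h.2.1⟩⟩
  loopless := ⟨fun _ h => h.1.ne rfl⟩

lemma prune_adj {R : V → V → Prop} {a b : V} :
    (prune G R).Adj a b ↔ G.Adj a b ∧ ¬ R a b ∧ ¬ R b a := Iff.rfl

lemma prune_le (R : V → V → Prop) : prune G R ≤ G := fun _ _ h => h.1

lemma prune_cost {R : V → V → Prop} {D : Finset (Sym2 V)}
    (h : ∀ a b, G.Adj a b → R a b → s(a, b) ∈ D) :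
    ∀ a b, G.Adj a b → ¬ (prune G R).Adj a b → s(a, b) ∈ D := by
  intro a b hab hn
  rw [prune_adj] at hn
  by_cases h1 : R a b
  · exact h a b hab h1
  by_cases h2 : R b a
  · rw [Sym2.eq_swap]; exact h b a hab.symm h2
  · exact absurd ⟨hab, h1, h2⟩ hn

/-- The edges that are removed to split off a star with centre `x`: those that join `x` to a
vertex which is not a leaf and, at a helper vertex `w`, those that lead neither to a neighbour
of `x` nor to a leaf. -/
def starCut (G : SimpleGraph V) (x w a b : V) : Prop :=
  (a = x ∧ ∃ c, c ≠ x ∧ G.Adj b c) ∨ (a = w ∧ b ≠ x ∧ ¬ G.Adj x b ∧ ∃ c, c ≠ w ∧ G.Adj b c)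

/-- Splitting off the star formed by `x` and its leaves gains one. In the new graph the helper `w`
is dominated either by a neighbour of `x`, so that `x` stays dominated without its leaf, or by a
leaf of `w`, which can be exchanged for the common neighbour `z` of `x` and `w`. -/
lemma isStep_starCut [Fintype V] (hG : ∀ v, ∃ w, G.Adj v w) {A : Finset V}
    (hA : ∀ a ∈ A, ∀ b, G.Adj a b → b ∈ A) {x p z w : V} (hx : x ∈ A) (hxp : G.Adj x p)
    (hp : ∀ c, G.Adj p c → c = x) (hxz : G.Adj x z) (hzw : G.Adj z w) (hwx : w ≠ x) :
    ∃ c, c + 2 ≤ A.card ∧ IsStep G (prune G (starCut G x w)) c 1 := by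
  have hzx : z ≠ x := hxz.ne'
  have hzw' : z ≠ w := hzw.ne
  have hwp : w ≠ p := by rintro rfl; exact hzx (hp z hzw.symm)
  have hwzkeep : (prune G (starCut G x w)).Adj w z := by
    refine ⟨hzw.symm, ?_, ?_⟩
    · rintro (h | h)
      exacts [hwx h.1, h.2.2.1 hxz]
    · rintro (h | h)
      exacts [hzx h.1, hzw' h.1]
  have hxleaf : ∀ q, G.Adj x q → (∀ c, G.Adj q c → c = x) →
      (prune G (starCut G x w)).Adj x q := by
    intro q hxq hq
    refine ⟨hxq, ?_, ?_⟩
    · rintro (⟨-, c, hc, hqc⟩ | h)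
      exacts [hc (hq c hqc), hwx h.1.symm]
    · rintro (⟨h, -⟩ | h)
      exacts [hxq.ne' h, h.2.1 rfl]
  have hxnbr : ∀ q, (prune G (starCut G x w)).Adj x q → ∀ c, G.Adj q c → c = x := by
    intro q hq c hqc
    by_contra hc
    exact hq.2.1 (Or.inl ⟨rfl, c, hc, hqc⟩)
  refine ⟨A.card - 2, ?_, prune_le _, ?_, ?_, ?_⟩
  · have : ({x, p} : Finset V) ⊆ A := by
      simp [Finset.insert_subset_iff, hx, hA x hx p hxp]
    have h2 := Finset.card_le_card this
    rw [Finset.card_pair hxp.ne] at h2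
    omega
  · intro v
    by_cases hvx : v = x
    · exact ⟨p, hvx ▸ hxleaf p hxp hp⟩
    by_cases hvw : v = w
    · exact ⟨z, hvw ▸ hwzkeep⟩
    by_cases hxv : G.Adj x v
    · by_cases hleaf : ∀ c, G.Adj v c → c = x
      · exact ⟨x, (hxleaf v hxv hleaf).symm⟩
      · push Not at hleaf
        obtain ⟨c, hvc, hc⟩ := hleaf
        refine ⟨c, hvc, ?_, ?_⟩
        · rintro (h | h)
          exacts [hvx h.1, hvw h.1]
        · rintro (h | h)
          exacts [hc h.1, h.2.2.1 hxv]
    · obtain ⟨u, hu⟩ := hG v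
      have hux : ∀ u, G.Adj v u → u ≠ x := by
        rintro u hu rfl; exact hxv hu.symm
      by_cases hex : ∃ u, G.Adj v u ∧ u ≠ w
      · obtain ⟨u, hu, huw⟩ := hex
        refine ⟨u, hu, ?_, ?_⟩
        · rintro (h | h)
          exacts [hvx h.1, hvw h.1]
        · rintro (h | h)
          exacts [hux u hu h.1, huw h.1]
      · push Not at hex
        refine ⟨u, hu, ?_, ?_⟩
        · rintro (h | h)
          exacts [hvx h.1, hvw h.1]
        · rintro (h | ⟨-, -, -, c, hc, hvc⟩)
          exacts [hux u hu h.1, hc (hex c hvc)]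
  · -- The two parts of the cut are counted against `N(x)` and its complement in `A`.
    set N := A.filter (G.Adj x) with hN
    refine ⟨((N.erase p).image fun b => s(x, b)) ∪
      (((A.filter (¬ G.Adj x ·)).erase x).image fun b => s(w, b)), ?_, prune_cost ?_⟩
    · refine (Finset.card_union_le _ _).trans ((Nat.add_le_add Finset.card_image_le
        Finset.card_image_le).trans ?_)
      have h1 : N.card + (A.filter (¬ G.Adj x ·)).card = A.card :=
        Finset.card_filter_add_card_filter_not _
      have h2 := Finset.card_erase_add_one
        (show p ∈ N from Finset.mem_filter.2 ⟨hA x hx p hxp, hxp⟩)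
      have h3 := Finset.card_erase_add_one
        (show x ∈ A.filter (¬ G.Adj x ·) from Finset.mem_filter.2 ⟨hx, fun h => h.ne rfl⟩)
      omega
    · have hwA : w ∈ A := hA z (hA x hx z hxz) w hzw
      rintro a b hab (⟨rfl, c, hc, hbc⟩ | ⟨rfl, hbx, hxb, -⟩)
      · refine Finset.mem_union_left _ (Finset.mem_image_of_mem _ (Finset.mem_erase.2
          ⟨?_, Finset.mem_filter.2 ⟨hA _ hx b hab, hab⟩⟩))
        rintro rfl
        exact hc (hp c hbc)
      · exact Finset.mem_union_right _ (Finset.mem_image_of_mem _ (Finset.mem_erase.2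
          ⟨hbx, Finset.mem_filter.2 ⟨hA _ hwA b hab, hxb⟩⟩))
  · intro S' hS'
    obtain ⟨p₀, hp₀S, hxp₀⟩ := hS' x
    have hp₀ := hxnbr p₀ hxp₀
    obtain ⟨x', hxS, hpx'⟩ := hS' p
    have hx'x : x' = x := hp x' hpx'.1
    subst hx'x
    obtain ⟨u, huS, hwu⟩ := hS' w
    have hux : u ≠ x' := by
      rintro rfl
      exact hzx (hxnbr w hwu.symm z hzw.symm)
    have hup₀ : u ≠ p₀ := by rintro rfl; exact hwx (hp₀ w hwu.1.symm)
    by_cases hxu : G.Adj x' u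
    · refine ⟨S'.erase p₀, fun v => ?_, ?_⟩
      · by_cases hv : v = x'
        · exact ⟨u, Finset.mem_erase.2 ⟨hup₀, huS⟩, hv ▸ hxu⟩
        · obtain ⟨s, hs, hvs⟩ := hS' v
          refine ⟨s, Finset.mem_erase.2 ⟨?_, hs⟩, hvs.1⟩
          rintro rfl
          exact hv (hp₀ v hvs.1.symm)
      · rw [Finset.card_erase_add_one hp₀S]
    · have hu : ∀ c, G.Adj u c → c = w := by
        intro c huc
        by_contra hc
        exact hwu.2.1 (Or.inr ⟨rfl, hux, hxu, c, hc, huc⟩)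
      refine ⟨insert z ((S'.erase p₀).erase u), fun v => ?_, ?_⟩
      · by_cases hv : v = x'
        · exact ⟨z, Finset.mem_insert_self _ _, hv ▸ hxz⟩
        by_cases hv' : v = w
        · exact ⟨z, Finset.mem_insert_self _ _, hv' ▸ hzw.symm⟩
        obtain ⟨s, hs, hvs⟩ := hS' v
        refine ⟨s, Finset.mem_insert_of_mem (Finset.mem_erase.2
          ⟨?_, Finset.mem_erase.2 ⟨?_, hs⟩⟩), hvs.1⟩
        · rintro rfl
          exact hv' (hu v hvs.1.symm)
        · rintro rfl
          exact hv (hp₀ v hvs.1.symm)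
      · have h1 := Finset.card_insert_le z ((S'.erase p₀).erase u)
        have h2 := Finset.card_erase_add_one (Finset.mem_erase.2 ⟨hup₀, huS⟩)
        have h3 := Finset.card_erase_add_one hp₀S
        omega

/-- A vertex `x` with a leaf `p` and a neighbour `z` that is not a leaf: a star centred at `x` can
be split off so that one is gained and the matching number does not drop. -/
lemma exists_star_step [Fintype V] (hG : ∀ v, ∃ w, G.Adj v w) {A : Finset V}
    (hA : ∀ a ∈ A, ∀ b, G.Adj a b → b ∈ A) {x p z : V} (hx : x ∈ A) (hxp : G.Adj x p)
    (hp : ∀ c, G.Adj p c → c = x) (hxz : G.Adj x z) (hz : ∃ w, w ≠ x ∧ G.Adj z w)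
    {m : Equiv.Perm V} (hm : IsMatchingPerm G m) :
    ∃ G' c, c + 2 ≤ A.card ∧ IsStep G G' c 1 ∧ x ∉ active G' ∧ p ∉ active G' ∧
      ∃ m', IsMatchingPerm G' m' ∧ m'.support.card = m.support.card := by
  -- It may be assumed that `x` is matched to a leaf, if at all.
  have hm₁ : ∃ m₁ : Equiv.Perm V, IsMatchingPerm G m₁ ∧ m₁.support.card = m.support.card ∧
      (m₁ x ≠ x → ∀ c, G.Adj (m₁ x) c → c = x) := by
    by_cases h : m x ≠ x → ∀ c, G.Adj (m x) c → c = x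
    · exact ⟨m, hm, rfl, h⟩
    push Not at h
    obtain ⟨h1, c, h2, h3⟩ := h
    have hmp : m p = p := by
      by_contra hmp
      have := hp _ (hm.adj p hmp)
      have hxp' : m x = p := by rw [← this, hm.inv]
      exact h3 (hp c (hxp' ▸ h2))
    obtain ⟨m₁, hinv, hx1, hp1, hmx, hrest, hcard⟩ := exists_rematch hm.inv hmp h1
    refine ⟨m₁, ⟨hinv, fun v hv => ?_⟩, hcard, fun _ => hx1 ▸ hp⟩
    by_cases hvx : v = x
    · rw [hvx, hx1]; exact hxp
    by_cases hvp : v = p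
    · rw [hvp, hp1]; exact hxp.symm
    by_cases hvm : v = m x
    · exact absurd (hvm ▸ hmx) hv
    · rw [hrest v hvx hvp hvm] at hv ⊢
      exact hm.adj v hv
  obtain ⟨m₁, hm₁, hcard, hmx⟩ := hm₁
  obtain ⟨w₀, hw₀x, hzw₀⟩ := hz
  have hzx : z ≠ x := hxz.ne'
  have hstep : ∀ w, G.Adj z w → w ≠ x → (∃ m', IsMatchingPerm (prune G (starCut G x w)) m' ∧
      m'.support.card = m₁.support.card) → ∃ G' c, c + 2 ≤ A.card ∧ IsStep G G' c 1 ∧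
      x ∉ active G' ∧ p ∉ active G' ∧
      ∃ m', IsMatchingPerm G' m' ∧ m'.support.card = m.support.card := by
    rintro w hzw hwx ⟨m', hm', hc'⟩
    obtain ⟨c, hc, hs⟩ := isStep_starCut hG hA hx hxp hp hxz hzw hwx
    have hstar : ∀ q, (prune G (starCut G x w)).Adj x q →
        ∀ c, (prune G (starCut G x w)).Adj q c → c = x := by
      intro q hq c hqc
      by_contra hc
      exact hq.2.1 (Or.inl ⟨rfl, c, hc, hqc.1⟩)
    have hact := notMem_active_of_star hstar
    refine ⟨_, c, hc, hs, hact.1, hact.2 p ?_, m', hm', hc'.trans hcard⟩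
    refine ⟨hxp, ?_, ?_⟩
    · rintro (⟨-, c, hc, hpc⟩ | h)
      exacts [hc (hp c hpc), hwx h.1.symm]
    · rintro (⟨h, -⟩ | h)
      exacts [hxp.ne' h, h.2.1 rfl]
  -- An edge that avoids `w` and, if it contains `x`, ends in a leaf is not removed.
  have hkeep : ∀ w u v, w ≠ x → G.Adj u v → u ≠ w → v ≠ w →
      (u = x → ∀ c, G.Adj v c → c = x) → (v = x → ∀ c, G.Adj u c → c = x) →
      (prune G (starCut G x w)).Adj u v := by
    intro w u v hwx huv hu hv h1 h2
    refine ⟨huv, ?_, ?_⟩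
    · rintro (⟨h, c, hc, hvc⟩ | h)
      exacts [hc (h1 h c hvc), hu h.1]
    · rintro (⟨h, c, hc, huc⟩ | h)
      exacts [hc (h2 h c huc), hv h.1]
  have hmatch : ∀ v, m₁ v ≠ v → (v = x → ∀ c, G.Adj (m₁ v) c → c = x) ∧
      (m₁ v = x → ∀ c, G.Adj v c → c = x) := by
    intro v hv
    refine ⟨fun h => ?_, fun h => ?_⟩
    · subst h; exact hmx hv
    · subst h
      have := hmx (hm₁.ne hv)
      rwa [hm₁.inv] at this
  -- If the matching edge at `w` survives, then so does the whole matching.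
  have hsame : ∀ w, w ≠ x → (m₁ w ≠ w → (prune G (starCut G x w)).Adj w (m₁ w)) →
      IsMatchingPerm (prune G (starCut G x w)) m₁ := by
    intro w hwx hw
    refine ⟨hm₁.inv, fun v hv => ?_⟩
    by_cases hvw : v = w
    · subst hvw; exact hw hv
    by_cases hvw' : m₁ v = w
    · have := hw (by rw [← hvw', hm₁.inv]; exact hv.symm)
      rw [← hvw', hm₁.inv] at this
      exact hvw' ▸ this.symm
    exact hkeep w v (m₁ v) hwx (hm₁.adj v hv) hvw hvw' (hmatch v hv).1 (hmatch v hv).2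
  have hwz : ∀ w, G.Adj z w → w ≠ x → (prune G (starCut G x w)).Adj w z := by
    intro w hzw hwx
    refine ⟨hzw.symm, ?_, ?_⟩
    · rintro (h | h)
      exacts [hwx h.1, h.2.2.1 hxz]
    · rintro (h | h)
      exacts [hzx h.1, hzw.ne h.1]
  by_cases hz : m₁ z = z
  · refine hstep w₀ hzw₀ hw₀x ?_
    by_cases hw : m₁ w₀ = w₀
    · exact ⟨m₁, hsame w₀ hw₀x fun h => absurd hw h, rfl⟩
    obtain ⟨m', hinv, hw', hz', hmw, hrest, hc'⟩ := exists_rematch hm₁.inv hz hw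
    refine ⟨m', ⟨hinv, fun v hv => ?_⟩, hc'⟩
    by_cases h1 : v = w₀
    · rw [h1, hw']; exact hwz w₀ hzw₀ hw₀x
    by_cases h2 : v = z
    · rw [h2, hz']; exact (hwz w₀ hzw₀ hw₀x).symm
    by_cases h3 : v = m₁ w₀
    · exact absurd (h3 ▸ hmw) hv
    · rw [hrest v h1 h2 h3] at hv ⊢
      refine hkeep w₀ v _ hw₀x (hm₁.adj v hv) h1 ?_ (hmatch v hv).1 (hmatch v hv).2
      intro h
      exact h3 (by rw [← h, hm₁.inv])
  · have hwx : m₁ z ≠ x := by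
      intro h
      have := (hmatch z hz).2 h w₀ hzw₀
      exact hw₀x this
    refine hstep (m₁ z) (hm₁.adj z hz) hwx ⟨m₁, hsame _ hwx fun _ => ?_, rfl⟩
    rw [hm₁.inv]
    exact hwz _ (hm₁.adj z hz) hwx

/-- Deleting all edges at `y` except one, and then splitting off the star at the remaining
neighbour of `y`, gains one. The hypothesis excludes that this neighbour is left with leaves only.
-/
lemma exists_step_of_vertex [Fintype V] (hG : ∀ v, ∃ w, G.Adj v w) {y : V} (hy : y ∈ active G)
    (hgood : ∀ x, G.Adj y x → ∃ z, z ≠ y ∧ G.Adj x z ∧ ∃ w, w ≠ x ∧ w ≠ y ∧ G.Adj z w)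
    {m : Equiv.Perm V} (hm : IsMatchingPerm G m) :
    ∃ G' c, c + 3 ≤ (active G).card + degIn G Finset.univ y ∧ IsStep G G' c 1 ∧
      (active G').card + 2 ≤ (active G).card ∧
      ∃ m', IsMatchingPerm G' m' ∧ m'.support.card = m.support.card := by
  -- Keep the matching edge at `y`, if there is one.
  obtain ⟨x, hyx, hmy⟩ : ∃ x, G.Adj y x ∧ (m y ≠ y → m y = x) := by
    by_cases h : m y = y
    · obtain ⟨x, hx⟩ := hG y
      exact ⟨x, hx, fun h' => absurd h h'⟩
    · exact ⟨m y, hm.adj y h, fun _ => rfl⟩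
  set R : V → V → Prop := fun a b => a = y ∧ b ≠ x with hR
  have hle : prune G R ≤ G := prune_le R
  have hkeep : ∀ a b, G.Adj a b → a ≠ y → b ≠ y → (prune G R).Adj a b := fun a b hab ha hb =>
    ⟨hab, fun h => ha h.1, fun h => hb h.1⟩
  have hyx' : (prune G R).Adj y x := ⟨hyx, fun h => h.2 rfl, fun h => hyx.ne' h.1⟩
  have hG₁ : ∀ v, ∃ w, (prune G R).Adj v w := by
    intro v
    by_cases h1 : v = y
    · exact ⟨x, h1 ▸ hyx'⟩
    by_cases h2 : G.Adj y v
    · obtain ⟨z, hz, hvz, -⟩ := hgood v h2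
      exact ⟨z, hkeep v z hvz h1 hz⟩
    · obtain ⟨w, hw⟩ := hG v
      refine ⟨w, hkeep v w hw h1 ?_⟩
      rintro rfl
      exact h2 hw.symm
  have hdeg : 1 ≤ degIn G Finset.univ y :=
    Finset.card_pos.2 ⟨x, by simpa using hyx⟩
  have hs₁ : IsStep G (prune G R) (degIn G Finset.univ y - 1) 0 := by
    refine ⟨hle, hG₁, ⟨((Finset.univ.filter (G.Adj y)).erase x).image fun b => s(y, b),
      ?_, prune_cost ?_⟩, fun S' hS' => ⟨S', fun v => ?_, le_rfl⟩⟩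
    · refine Finset.card_image_le.trans ?_
      rw [Finset.card_erase_of_mem (by simpa using hyx), degIn]
    · rintro a b hab ⟨rfl, hb⟩
      exact Finset.mem_image_of_mem _ (Finset.mem_erase.2 ⟨hb, by simpa using hab⟩)
    · obtain ⟨w, hw, h⟩ := hS' v
      exact ⟨w, hw, hle h⟩
  have hm₁ : IsMatchingPerm (prune G R) m := by
    refine ⟨hm.inv, fun v hv => ⟨hm.adj v hv, ?_, ?_⟩⟩
    · rintro ⟨rfl, h⟩
      exact h (hmy hv)
    · rintro ⟨h1, h2⟩
      have h3 := hmy (by rw [← h1, hm.inv]; exact hv.symm)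
      rw [← h1, hm.inv] at h3
      exact h2 h3
  obtain ⟨z, hzy, hxz, w, hwx, hwy, hzw⟩ := hgood x hyx
  have hxA : x ∈ active G := active_closed hy hyx
  obtain ⟨G', c, hc, hs, hx', hy', m', hm', hcard⟩ := exists_star_step hG₁
    (A := active G) (fun a ha b hab => active_closed ha (hle hab)) hxA hyx'.symm
    (fun c hc => by
      by_contra h
      exact hc.2.1 ⟨rfl, h⟩)
    (hkeep x z hxz hyx.ne' hzy) ⟨w, hwx, hkeep z w hzw hzy hwy⟩ hm₁
  refine ⟨G', degIn G Finset.univ y - 1 + c, by omega, by simpa using hs₁.trans hs, ?_,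
    m', hm', hcard⟩
  have hsub : active G' ⊆ ((active G).erase x).erase y := by
    intro v hv
    refine Finset.mem_erase.2 ⟨?_, Finset.mem_erase.2 ⟨?_, active_mono (hs.le.trans hle) hv⟩⟩
    · rintro rfl; exact hy' hv
    · rintro rfl; exact hx' hv
  have h1 := Finset.card_le_card hsub
  have h2 := Finset.card_erase_add_one (Finset.mem_erase.2 ⟨hyx.ne, hy⟩)
  have h3 := Finset.card_erase_add_one hxA
  omega

end Steps

/-! ### Splitting off an edge -/

section PairStep

open scoped Classical

variable {V : Type*} {G H : SimpleGraph V}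

/-- The edges that are removed to split off the edge `xy` as a component: all others at `x` and `y`
and, at two helper vertices `w` and `w'`, those that do not lead to a neighbour of `x` and of `y`,
respectively. -/
def pairCut (G : SimpleGraph V) (x y w w' a b : V) : Prop :=
  (a = x ∧ b ≠ y) ∨ (a = y ∧ b ≠ x) ∨ (a = w ∧ ¬ G.Adj x b) ∨ (a = w' ∧ ¬ G.Adj y b)

/-- Splitting off `xy` gains two: whatever dominates the helpers also dominates `x` and `y`, so that
these two can be omitted. The edges removed at the helpers are paid for by the non-neighbours of
`x` and of `y`. -/
lemma isStep_pairCut {A : Finset V} (hA : ∀ a ∈ A, ∀ b, G.Adj a b → b ∈ A) {x y w w' : V}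
    (hx : x ∈ A) (hxy : G.Adj x y) (hw : w ∈ A) (hw' : w' ∈ A) (hwx : w ≠ x) (hwy : w ≠ y)
    (hwx' : w' ≠ x) (hwy' : w' ≠ y) (hno : ∀ v, ∃ u, (prune G (pairCut G x y w w')).Adj v u) :
    ∃ c, c + 4 ≤ 2 * A.card ∧ IsStep G (prune G (pairCut G x y w w')) c 2 := by
  have hy : y ∈ A := hA x hx y hxy
  have hxnbr : ∀ u, (prune G (pairCut G x y w w')).Adj x u → u = y := fun u hu => by
    by_contra h
    exact hu.2.1 (Or.inl ⟨rfl, h⟩)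
  have hynbr : ∀ u, (prune G (pairCut G x y w w')).Adj y u → u = x := fun u hu => by
    by_contra h
    exact hu.2.1 (Or.inr (Or.inl ⟨rfl, h⟩))
  set Nx := A.filter (G.Adj x) with hNx
  set Ny := A.filter (G.Adj y) with hNy
  have h1 : Nx.card + (A.filter (¬ G.Adj x ·)).card = A.card :=
    Finset.card_filter_add_card_filter_not _
  have h2 : Ny.card + (A.filter (¬ G.Adj y ·)).card = A.card :=
    Finset.card_filter_add_card_filter_not _
  have h3 := Finset.card_erase_add_one (show y ∈ Nx from Finset.mem_filter.2 ⟨hy, hxy⟩)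
  have h4 := Finset.card_erase_add_one (show x ∈ Ny from Finset.mem_filter.2 ⟨hx, hxy.symm⟩)
  have h5 := Finset.card_erase_add_one
    (show x ∈ A.filter (¬ G.Adj x ·) from Finset.mem_filter.2 ⟨hx, fun h => h.ne rfl⟩)
  have h6 := Finset.card_erase_add_one
    (show y ∈ A.filter (¬ G.Adj y ·) from Finset.mem_filter.2 ⟨hy, fun h => h.ne rfl⟩)
  refine ⟨2 * A.card - 4, by omega, prune_le _, hno, ?_, ?_⟩
  · refine ⟨(((Nx.erase y).image fun b => s(x, b)) ∪ ((Ny.erase x).image fun b => s(y, b))) ∪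
      ((((A.filter (¬ G.Adj x ·)).erase x).image fun b => s(w, b)) ∪
      (((A.filter (¬ G.Adj y ·)).erase y).image fun b => s(w', b))), ?_, prune_cost ?_⟩
    · refine (Finset.card_union_le _ _).trans ((Nat.add_le_add
        ((Finset.card_union_le _ _).trans (Nat.add_le_add Finset.card_image_le
          Finset.card_image_le))
        ((Finset.card_union_le _ _).trans (Nat.add_le_add Finset.card_image_le
          Finset.card_image_le))).trans ?_)
      omega
    · have key₁ : ∀ b, G.Adj x b → b ≠ y → s(x, b) ∈ (Nx.erase y).image fun b => s(x, b) :=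
        fun b hb hby => Finset.mem_image_of_mem _
          (Finset.mem_erase.2 ⟨hby, Finset.mem_filter.2 ⟨hA x hx b hb, hb⟩⟩)
      have key₂ : ∀ b, G.Adj y b → b ≠ x → s(y, b) ∈ (Ny.erase x).image fun b => s(y, b) :=
        fun b hb hbx => Finset.mem_image_of_mem _
          (Finset.mem_erase.2 ⟨hbx, Finset.mem_filter.2 ⟨hA y hy b hb, hb⟩⟩)
      rintro a b hab (⟨rfl, hb⟩ | ⟨rfl, hb⟩ | ⟨rfl, hb⟩ | ⟨rfl, hb⟩)
      · exact Finset.mem_union_left _ (Finset.mem_union_left _ (key₁ b hab hb))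
      · exact Finset.mem_union_left _ (Finset.mem_union_right _ (key₂ b hab hb))
      · by_cases hbx : b = x
        · subst hbx
          rw [Sym2.eq_swap]
          exact Finset.mem_union_left _ (Finset.mem_union_left _ (key₁ a hab.symm hwy))
        · exact Finset.mem_union_right _ (Finset.mem_union_left _ (Finset.mem_image_of_mem _
            (Finset.mem_erase.2 ⟨hbx, Finset.mem_filter.2 ⟨hA a hw b hab, hb⟩⟩)))
      · by_cases hby : b = y
        · subst hby
          rw [Sym2.eq_swap]
          exact Finset.mem_union_left _ (Finset.mem_union_right _ (key₂ a hab.symm hwx'))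
        · exact Finset.mem_union_right _ (Finset.mem_union_right _ (Finset.mem_image_of_mem _
            (Finset.mem_erase.2 ⟨hby, Finset.mem_filter.2 ⟨hA a hw' b hab, hb⟩⟩)))
  · intro S' hS'
    have hyS : y ∈ S' := by
      obtain ⟨u, hu, h⟩ := hS' x
      exact hxnbr u h ▸ hu
    have hxS : x ∈ S' := by
      obtain ⟨u, hu, h⟩ := hS' y
      exact hynbr u h ▸ hu
    have hmem : ∀ v s, v ≠ x → v ≠ y → s ∈ S' → (prune G (pairCut G x y w w')).Adj v s →
        s ∈ (S'.erase x).erase y := by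
      intro v s hvx hvy hs hvs
      refine Finset.mem_erase.2 ⟨?_, Finset.mem_erase.2 ⟨?_, hs⟩⟩
      · rintro rfl; exact hvx (hynbr v hvs.symm)
      · rintro rfl; exact hvy (hxnbr v hvs.symm)
    refine ⟨(S'.erase x).erase y, fun v => ?_, ?_⟩
    · by_cases hvx : v = x
      · obtain ⟨u, hu, h⟩ := hS' w
        refine ⟨u, hmem w u hwx hwy hu h, ?_⟩
        by_contra hn
        exact h.2.1 (Or.inr (Or.inr (Or.inl ⟨rfl, hvx ▸ hn⟩)))
      by_cases hvy : v = y
      · obtain ⟨u, hu, h⟩ := hS' w'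
        refine ⟨u, hmem w' u hwx' hwy' hu h, ?_⟩
        by_contra hn
        exact h.2.1 (Or.inr (Or.inr (Or.inr ⟨rfl, hvy ▸ hn⟩)))
      obtain ⟨s, hs, h⟩ := hS' v
      exact ⟨s, hmem v s hvx hvy hs h, h.1⟩
    · have h1 := Finset.card_erase_add_one (Finset.mem_erase.2 ⟨hxy.ne', hyS⟩)
      have h2 := Finset.card_erase_add_one hxS
      omega

/-- The edge `xy` is split off with helper `w`, adjacent to the neighbour `z` of `x`, and helper
`w'`, adjacent to the neighbour `z'` of `y`. The subgraph `H` of `G` certifies that no vertex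
becomes isolated: each of its vertices in the closed set `B` has degree at least three, and at
most two of the edges at a vertex other than `x, y, w, w'` are removed. -/
lemma exists_pair_step_of_helpers [Fintype V] (hHG : H ≤ G) (hH : ∀ v, ∃ u, H.Adj v u)
    {A B : Finset V}
    (hA : ∀ a ∈ A, ∀ b, G.Adj a b → b ∈ A) (hB : ∀ a ∈ B, ∀ b, H.Adj a b → b ∈ B) (hBA : B ⊆ A)
    (hdeg : ∀ v ∈ B, ∀ a b, ∃ u, H.Adj v u ∧ u ≠ a ∧ u ≠ b) {x y z w z' w' : V} (hx : x ∈ B)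
    (hxy : H.Adj x y) (hxz : H.Adj x z) (hzw : H.Adj z w) (hyz : H.Adj y z') (hzw' : H.Adj z' w')
    (hzy : z ≠ y) (hzx' : z' ≠ x) (hwx : w ≠ x) (hwy : w ≠ y) (hwx' : w' ≠ x) (hwy' : w' ≠ y)
    (h1 : w' = w → H.Adj y z ∧ H.Adj x z') (h2 : w' = z → H.Adj y w) (h3 : w = z' → H.Adj x w')
    {m : Equiv.Perm V} (hm : IsMatchingPerm H m) (hmx : m x = y) (hmw : m w ≠ w → m w = z)
    (hmw' : m w' ≠ w' → m w' = z') :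
    ∃ G' c, c + 4 ≤ 2 * A.card ∧ IsStep G G' c 2 ∧ (x ∉ active G' ∧ y ∉ active G') ∧
      IsMatchingPerm G' m := by
  have hy : y ∈ B := hB x hx y hxy
  have hz : z ∈ B := hB x hx z hxz
  have hw : w ∈ B := hB z hz w hzw
  have hz' : z' ∈ B := hB y hy z' hyz
  have hw' : w' ∈ B := hB z' hz' w' hzw'
  set K := prune G (pairCut G x y w w') with hK
  have hkeep : ∀ u v, H.Adj u v → u ≠ x → u ≠ y → v ≠ x → v ≠ y → (u = w → G.Adj x v) →
      (u = w' → G.Adj y v) → (v = w → G.Adj x u) → (v = w' → G.Adj y u) → K.Adj u v := by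
    intro u v huv k1 k2 k3 k4 k5 k6 k7 k8
    refine ⟨hHG huv, ?_, ?_⟩
    · rintro (h | h | h | h)
      exacts [k1 h.1, k2 h.1, h.2 (k5 h.1), h.2 (k6 h.1)]
    · rintro (h | h | h | h)
      exacts [k3 h.1, k4 h.1, h.2 (k7 h.1), h.2 (k8 h.1)]
  have hKxy : K.Adj x y := by
    refine ⟨hHG hxy, ?_, ?_⟩
    · rintro (h | h | h | h)
      exacts [h.2 rfl, hxy.ne h.1, hwx h.1.symm, hwx' h.1.symm]
    · rintro (h | h | h | h)
      exacts [hxy.ne' h.1, h.2 rfl, hwy h.1.symm, hwy' h.1.symm]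
  have hKwz : K.Adj w z := hkeep w z hzw.symm hwx hwy hxz.ne' hzy (fun _ => hHG hxz)
    (fun h => hHG (h1 h.symm).1) (fun h => absurd h hzw.ne) (fun h => hHG (h2 h.symm))
  have hKwz' : K.Adj w' z' := hkeep w' z' hzw'.symm hwx' hwy' hzx' hyz.ne'
    (fun h => hHG (h1 h).2) (fun _ => hHG hyz) (fun h => hHG (h3 h.symm))
    (fun h => absurd h hzw'.ne)
  have hno : ∀ v, ∃ u, K.Adj v u := by
    intro v
    by_cases hvB : v ∈ B
    · by_cases hvx : v = x
      · exact ⟨y, hvx ▸ hKxy⟩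
      by_cases hvy : v = y
      · exact ⟨x, hvy ▸ hKxy.symm⟩
      by_cases hvw : v = w
      · exact ⟨z, hvw ▸ hKwz⟩
      by_cases hvw' : v = w'
      · exact ⟨z', hvw' ▸ hKwz'⟩
      have key : ∀ u, H.Adj v u → u ≠ x → u ≠ y → (u = w → G.Adj x v) → (u = w' → G.Adj y v) →
          ∃ u, K.Adj v u := fun u hu k1 k2 k3 k4 =>
        ⟨u, hkeep v u hu hvx hvy k1 k2 (fun h => absurd h hvw) (fun h => absurd h hvw') k3 k4⟩
      by_cases hxv : G.Adj x v <;> by_cases hyv : G.Adj y v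
      · obtain ⟨u, hu, ha, hb⟩ := hdeg v hvB x y
        exact key u hu ha hb (fun _ => hxv) (fun _ => hyv)
      · obtain ⟨u, hu, ha, hb⟩ := hdeg v hvB x w'
        exact key u hu ha (fun h => hyv (h ▸ hHG hu.symm)) (fun _ => hxv) (fun h => absurd h hb)
      · obtain ⟨u, hu, ha, hb⟩ := hdeg v hvB y w
        exact key u hu (fun h => hxv (h ▸ hHG hu.symm)) ha (fun h => absurd h hb) (fun _ => hyv)
      · obtain ⟨u, hu, ha, hb⟩ := hdeg v hvB w w'
        exact key u hu (fun h => hxv (h ▸ hHG hu.symm)) (fun h => hyv (h ▸ hHG hu.symm))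
          (fun h => absurd h ha) (fun h => absurd h hb)
    · obtain ⟨u, hu⟩ := hH v
      have huB : u ∉ B := fun h => hvB (hB u h v hu.symm)
      have hne : ∀ a ∈ B, v ≠ a ∧ u ≠ a := by
        intro a ha
        constructor
        · rintro rfl; exact hvB ha
        · rintro rfl; exact huB ha
      exact ⟨u, hkeep v u hu (hne x hx).1 (hne y hy).1 (hne x hx).2 (hne y hy).2
        (fun h => absurd h (hne w hw).1) (fun h => absurd h (hne w' hw').1)
        (fun h => absurd h (hne w hw).2) (fun h => absurd h (hne w' hw').2)⟩
  obtain ⟨c, hc, hs⟩ := isStep_pairCut hA (hBA hx) (hHG hxy) (hBA hw) (hBA hw') hwx hwy hwx' hwy'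
    hno
  have hxnbr : ∀ u, K.Adj x u → u = y := fun u hu => by
    by_contra h
    exact hu.2.1 (Or.inl ⟨rfl, h⟩)
  have hynbr : ∀ u, K.Adj y u → u = x := fun u hu => by
    by_contra h
    exact hu.2.1 (Or.inr (Or.inl ⟨rfl, h⟩))
  have hact := notMem_active_of_star (G := K) (x := x) (fun p hp c hpc =>
    hynbr c (hxnbr p hp ▸ hpc))
  refine ⟨K, c, hc, hs, ⟨hact.1, hact.2 y hKxy⟩, hm.inv, fun v hv => ?_⟩
  have hmy : m y = x := by rw [← hmx, hm.inv]
  by_cases hvx : v = x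
  · rw [hvx, hmx]; exact hKxy
  by_cases hvy : v = y
  · rw [hvy, hmy]; exact hKxy.symm
  have hmvx : m v ≠ x := fun h => hvy (by rw [← hmx, ← h, hm.inv])
  have hmvy : m v ≠ y := fun h => hvx (by rw [← hmy, ← h, hm.inv])
  by_cases hvw : v = w
  · rw [hvw] at hv ⊢; rw [hmw hv]; exact hKwz
  by_cases hvw' : v = w'
  · rw [hvw'] at hv ⊢; rw [hmw' hv]; exact hKwz'
  by_cases hmvw : m v = w
  · have hvz : v = z := by
      rw [← hmw (by rw [← hmvw, hm.inv]; exact hv.symm), ← hmvw, hm.inv]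
    rw [hmvw, hvz]; exact hKwz.symm
  by_cases hmvw' : m v = w'
  · have hvz : v = z' := by
      rw [← hmw' (by rw [← hmvw', hm.inv]; exact hv.symm), ← hmvw', hm.inv]
    rw [hmvw', hvz]; exact hKwz'.symm
  exact hkeep v (m v) (hm.adj v hv) hvx hvy hmvx hmvy (fun h => absurd h hvw)
    (fun h => absurd h hvw') (fun h => absurd h hmvw) (fun h => absurd h hmvw')

/-- If a closed set `B` of a subgraph `H` of `G` has minimum degree at least three in `H`, two can
be gained by splitting off an edge of a maximum matching of `H`. As long as both ends of some
matching edge have further matched neighbours, their partners serve as helpers. Otherwise every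
matching edge has an end whose only matched neighbour is its partner, and the other end then has
matched neighbours only, by maximality. -/
lemma exists_pair_step [Fintype V] (hHG : H ≤ G) (hH : ∀ v, ∃ u, H.Adj v u) {A B : Finset V}
    (hA : ∀ a ∈ A, ∀ b, G.Adj a b → b ∈ A) (hB : ∀ a ∈ B, ∀ b, H.Adj a b → b ∈ B) (hBA : B ⊆ A)
    (hne : B.Nonempty) (hdeg : ∀ v ∈ B, ∀ a b, ∃ u, H.Adj v u ∧ u ≠ a ∧ u ≠ b)
    {m : Equiv.Perm V} (hm : IsMatchingPerm H m)
    (hmax : ∀ m' : Equiv.Perm V, IsMatchingPerm H m' → m'.support.card ≤ m.support.card) :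
    ∃ G' c, c + 4 ≤ 2 * A.card ∧ IsStep G G' c 2 ∧
      (∃ x ∈ A, ∃ y ∈ A, x ≠ y ∧ x ∉ active G' ∧ y ∉ active G') ∧
      ∃ m', IsMatchingPerm G' m' ∧ m'.support.card = m.support.card := by
  have hindep : ∀ a b, H.Adj a b → m a = a → m b ≠ b := by
    intro a b hab ha hb
    obtain ⟨m', hm', hlt⟩ := exists_lt_of_unmatched hm hab ha hb
    exact absurd (hmax m' hm') (by omega)
  by_cases hgood : ∃ x ∈ B, m x ≠ x ∧ (∃ z, H.Adj x z ∧ z ≠ m x ∧ m z ≠ z) ∧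
      ∃ z, H.Adj (m x) z ∧ z ≠ x ∧ m z ≠ z
  · obtain ⟨x, hx, hmx, ⟨z, hxz, hzy, hz⟩, z', hyz, hzx', hz'⟩ := hgood
    have hwx : ∀ v, v ≠ m x → m v ≠ x := fun v hv h => hv (by rw [← h, hm.inv])
    have hwy : ∀ v, v ≠ x → m v ≠ m x := fun v hv h => hv (m.injective h)
    obtain ⟨G', c, hc, hs, hact, hm'⟩ := exists_pair_step_of_helpers hHG hH hA hB hBA hdeg hx
      (hm.adj x hmx) hxz (hm.adj z hz) hyz (hm.adj z' hz') hzy hzx' (hwx z hzy)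
      (hwy z hxz.ne') (hwx z' hyz.ne') (hwy z' hzx')
      (fun h => by
        have := m.injective h
        subst this
        exact ⟨hyz, hxz⟩)
      (fun h => by rw [← h, hm.inv]; exact hyz) (fun h => by rw [← h, hm.inv]; exact hxz)
      hm rfl (fun _ => hm.inv z) (fun _ => hm.inv z')
    exact ⟨G', c, hc, hs, ⟨x, hBA hx, m x, hBA (hB x hx _ (hm.adj x hmx)), hmx.symm, hact⟩, m,
      hm', rfl⟩
  push Not at hgood
  -- An end whose other neighbours are all unmatched leaves its partner no unmatched neighbour.
  have haug : ∀ x ∈ B, m x ≠ x → (∀ z, H.Adj x z → z ≠ m x → m z = z) →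
      ∀ u, H.Adj (m x) u → m u ≠ u := by
    intro x hx hmx hbad u hu hmu
    obtain ⟨v, hxv, hvy, hvu⟩ := hdeg x hx (m x) u
    have hv := hbad v hxv hvy
    obtain ⟨m', hinv, hx', hv', hmx', hrest, hcard⟩ := exists_rematch hm.inv hv hmx
    have hm' : IsMatchingPerm H m' := by
      refine ⟨hinv, fun a ha => ?_⟩
      by_cases h1 : a = x
      · rw [h1, hx']; exact hxv
      by_cases h2 : a = v
      · rw [h2, hv']; exact hxv.symm
      by_cases h3 : a = m x
      · exact absurd (h3 ▸ hmx') ha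
      · rw [hrest a h1 h2 h3] at ha ⊢
        exact hm.adj a ha
    have hux : u ≠ x := by rintro rfl; exact hmx hmu
    have hmu' : m' u = u := by rw [hrest u hux hvu.symm hu.ne', hmu]
    obtain ⟨m'', hm'', hlt⟩ := exists_lt_of_unmatched hm' hu hmx' hmu'
    exact absurd (hmax m'' hm'') (by omega)
  have hex : ∃ x ∈ B, m x ≠ x := by
    obtain ⟨b, hb⟩ := hne
    by_cases h : m b = b
    · obtain ⟨u, hu⟩ := hH b
      exact ⟨u, hB b hb u hu, hindep b u hu h⟩
    · exact ⟨b, hb, h⟩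
  have hex' : ∃ x ∈ B, m x ≠ x ∧ ∀ z, H.Adj x z → z ≠ m x → m z = z := by
    obtain ⟨x, hx, hmx⟩ := hex
    by_cases h : ∃ z, H.Adj x z ∧ z ≠ m x ∧ m z ≠ z
    · refine ⟨m x, hB x hx _ (hm.adj x hmx), hm.ne hmx, ?_⟩
      rw [hm.inv]
      exact hgood x hx hmx h
    · push Not at h
      exact ⟨x, hx, hmx, h⟩
  obtain ⟨x, hx, hmx, hbad⟩ := hex'
  have hy : m x ∈ B := hB x hx _ (hm.adj x hmx)
  have hymatched := haug x hx hmx hbad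
  obtain ⟨z', hyz, hzx', -⟩ := hdeg _ hy x x
  have hz'm : m z' ≠ z' := hymatched z' hyz
  have hz'B : z' ∈ B := hB _ hy _ hyz
  have hwx' : m z' ≠ x := fun h => hyz.ne' (by rw [← h, hm.inv])
  have hwy' : m z' ≠ m x := fun h => hzx' (m.injective h)
  -- The neighbour `z'` has the matched neighbour `m x`, so its partner is the restricted end.
  have hbad' : ∀ u, H.Adj (m z') u → u ≠ z' → m u = u :=
    hgood z' hz'B hz'm ⟨m x, hyz.symm, hwy'.symm, hm.ne hmx⟩
  have hz'matched : ∀ u, H.Adj z' u → m u ≠ u := by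
    have := haug (m z') (hB _ hz'B _ (hm.adj z' hz'm)) (hm.ne hz'm) (by rw [hm.inv]; exact hbad')
    rwa [hm.inv] at this
  obtain ⟨z, hxz, hzy, -⟩ := hdeg x hx (m x) x
  have hz := hbad z hxz hzy
  obtain ⟨w, hzw, hwx, hww'⟩ := hdeg z (hB x hx z hxz) x (m z')
  have hwy : w ≠ m x := by rintro rfl; exact hymatched z hzw.symm hz
  have hwz' : w ≠ z' := by rintro rfl; exact hz'matched z hzw.symm hz
  have hw := hindep z w hzw hz
  obtain ⟨m', hinv, hmw, hmz, hmw2, hrest, hcard⟩ := exists_rematch hm.inv hz hw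
  have hm' : IsMatchingPerm H m' := by
    refine ⟨hinv, fun a ha => ?_⟩
    by_cases h1 : a = w
    · rw [h1, hmw]; exact hzw.symm
    by_cases h2 : a = z
    · rw [h2, hmz]; exact hzw
    by_cases h3 : a = m w
    · exact absurd (h3 ▸ hmw2) ha
    · rw [hrest a h1 h2 h3] at ha ⊢
      exact hm.adj a ha
  have hmx' : m' x = m x := hrest x hwx.symm hxz.ne (fun h => hwy (by rw [h, hm.inv]))
  have hmz' : m' (m z') = z' := by
    rw [hrest (m z') hww'.symm (fun h => by
      rw [← h, hm.inv] at hz; exact hz'm hz.symm) (fun h => hwz' (m.injective h).symm), hm.inv]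
  obtain ⟨G', c, hc, hs, hact, hm''⟩ := exists_pair_step_of_helpers hHG hH hA hB hBA hdeg hx
    (hm.adj x hmx) hxz hzw hyz (hm.adj z' hz'm) hzy hzx' hwx hwy hwx' hwy'
    (fun h => absurd h.symm hww')
    (fun h => by rw [← h, hm.inv] at hz; exact absurd hz.symm hz'm)
    (fun h => absurd h hwz') hm' hmx' (fun _ => hmw) (fun _ => hmz')
  exact ⟨G', c, hc, hs, ⟨x, hBA hx, m x, hBA hy, hmx.symm, hact⟩, m', hm'', hcard⟩

end PairStep

/-! ### Gaining one or two -/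

section Gain

open scoped Classical

variable {V : Type*}

lemma IsTriangleComponent.rotate {G : SimpleGraph V} {a b c : V}
    (h : IsTriangleComponent G a b c) : IsTriangleComponent G b c a :=
  ⟨fun d => (h.2.1 d).trans or_comm, fun d => (h.2.2 d).trans or_comm, h.1⟩

lemma IsTriangleComponent.swap {G : SimpleGraph V} {a b c : V}
    (h : IsTriangleComponent G a b c) : IsTriangleComponent G a c b :=
  ⟨fun d => (h.1 d).trans or_comm, h.2.2, h.2.1⟩

/-- In a complete component with `s ≥ 5` vertices, one can be gained by deleting `2s - 5` edges,
namely a pentagon `x a c u b` in which the vertex `c` is replaced by an independent set. Any two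
vertices have a common closed neighbour in that graph, so no two vertices dominate the rest of the
clique. -/
lemma exists_clique_step {G : SimpleGraph V} (hG : ∀ v, ∃ w, G.Adj v w) {A : Finset V}
    (hA : ∀ a ∈ A, ∀ b, G.Adj a b → b ∈ A) (hclique : ∀ a ∈ A, ∀ b ∈ A, a ≠ b → G.Adj a b)
    (hcard : 5 ≤ A.card) : ∃ G' c, c + 5 ≤ 2 * A.card ∧ IsStep G G' c 1 := by
  obtain ⟨x, hx⟩ := Finset.card_pos.1 (show 0 < A.card by omega)
  have c1 := Finset.card_erase_add_one hx
  obtain ⟨a, ha⟩ := Finset.card_pos.1 (show 0 < (A.erase x).card by omega)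
  have c2 := Finset.card_erase_add_one ha
  obtain ⟨b, hb⟩ := Finset.card_pos.1 (show 0 < ((A.erase x).erase a).card by omega)
  have c3 := Finset.card_erase_add_one hb
  obtain ⟨u, hu⟩ := Finset.card_pos.1 (show 0 < (((A.erase x).erase a).erase b).card by omega)
  have c4 := Finset.card_erase_add_one hu
  set C := (((A.erase x).erase a).erase b).erase u with hC
  obtain ⟨c₀, hc₀⟩ := Finset.card_pos.1 (show 0 < C.card by omega)
  have hCmem : ∀ v, v ∈ C ↔ v ≠ u ∧ v ≠ b ∧ v ≠ a ∧ v ≠ x ∧ v ∈ A := by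
    intro v; simp only [hC, Finset.mem_erase]
  simp only [Finset.mem_erase] at ha hb hu
  obtain ⟨hax, haA⟩ := ha
  obtain ⟨hba, hbx, hbA⟩ := hb
  obtain ⟨hub, hua, hux, huA⟩ := hu
  have hsplit : ∀ v ∈ A, v = x ∨ v = a ∨ v = b ∨ v = u ∨ v ∈ C := by
    intro v hv
    rw [hCmem]
    tauto
  set R : V → V → Prop := fun p q => (p = x ∧ q = a) ∨ (p = x ∧ q = b) ∨ (p = b ∧ q = u) ∨
    (p = a ∧ q ∈ C) ∨ (p = u ∧ q ∈ C) with hR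
  have hc₀' := (hCmem c₀).1 hc₀
  have hRA : ∀ p q, R p q → p ∈ A := by
    rintro p q (h | h | h | h | h) <;> rw [h.1] <;> assumption
  have hnx : x ∉ C := fun h => ((hCmem x).1 h).2.2.2.1 rfl
  have hna : a ∉ C := fun h => ((hCmem a).1 h).2.2.1 rfl
  have hnb : b ∉ C := fun h => ((hCmem b).1 h).2.1 rfl
  have hnu : u ∉ C := fun h => ((hCmem u).1 h).1 rfl
  refine ⟨prune G R, 2 * A.card - 5, by omega, prune_le _, ?_, ?_, ?_⟩
  · have kxu : (prune G R).Adj x u := by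
      refine ⟨hclique x hx u huA hux.symm, ?_, ?_⟩ <;> simp only [hR] <;> grind
    have kab : (prune G R).Adj a b := by
      refine ⟨hclique a haA b hbA hba.symm, ?_, ?_⟩ <;> simp only [hR] <;> grind
    intro v
    by_cases hv : v ∈ A
    · rcases hsplit v hv with rfl | rfl | rfl | rfl | h
      · exact ⟨u, kxu⟩
      · exact ⟨b, kab⟩
      · exact ⟨a, kab.symm⟩
      · exact ⟨x, kxu.symm⟩
      · have h' := (hCmem v).1 h
        refine ⟨x, hclique v hv x hx h'.2.2.2.1, ?_, ?_⟩ <;> simp only [hR] <;> grind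
    · obtain ⟨w, hw⟩ := hG v
      exact ⟨w, hw, fun h => hv (hRA _ _ h), fun h => hv (hA w (hRA _ _ h) v hw.symm)⟩
  · refine ⟨({s(x, a), s(x, b), s(b, u)} : Finset (Sym2 V)) ∪ (C.image (fun c => s(a, c)) ∪
      C.image (fun c => s(u, c))), ?_, prune_cost ?_⟩
    · refine (Finset.card_union_le _ _).trans ((Nat.add_le_add Finset.card_le_three
        ((Finset.card_union_le _ _).trans (Nat.add_le_add Finset.card_image_le
          Finset.card_image_le))).trans ?_)
      omega
    · rintro p q - (⟨rfl, rfl⟩ | ⟨rfl, rfl⟩ | ⟨rfl, rfl⟩ | ⟨rfl, h⟩ | ⟨rfl, h⟩)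
      · exact Finset.mem_union_left _ (by simp)
      · exact Finset.mem_union_left _ (by simp)
      · exact Finset.mem_union_left _ (by simp)
      · exact Finset.mem_union_right _ (Finset.mem_union_left _ (Finset.mem_image_of_mem _ h))
      · exact Finset.mem_union_right _ (Finset.mem_union_right _ (Finset.mem_image_of_mem _ h))
  · intro S' hS'
    have hdom : ∀ v ∈ A, ∃ s ∈ S' ∩ A, s ≠ v ∧ ¬ R v s ∧ ¬ R s v := by
      intro v hv
      obtain ⟨s, hs, h⟩ := hS' v
      exact ⟨s, Finset.mem_inter.2 ⟨hs, hA v hv s h.1⟩, h.1.ne', h.2⟩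
    have hthree : 2 < (S' ∩ A).card := by
      obtain ⟨s₁, h₁, hn₁⟩ := hdom u huA
      have h₁' : s₁ = a ∨ s₁ = x := by
        have := hsplit s₁ (Finset.mem_inter.1 h₁).2
        simp only [hR] at hn₁
        grind
      obtain ⟨s₂, h₂, hn₂⟩ := hdom a haA
      have h₂' : s₂ = b ∨ s₂ = u := by
        have := hsplit s₂ (Finset.mem_inter.1 h₂).2
        simp only [hR] at hn₂
        grind
      obtain ⟨s₃, h₃, hn₃⟩ := hdom x hx
      have h₃' : s₃ = u ∨ s₃ ∈ C := by
        have := hsplit s₃ (Finset.mem_inter.1 h₃).2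
        simp only [hR] at hn₃
        grind
      obtain ⟨s₄, h₄, hn₄⟩ := hdom b hbA
      have h₄' : s₄ = a ∨ s₄ ∈ C := by
        have := hsplit s₄ (Finset.mem_inter.1 h₄).2
        simp only [hR] at hn₄
        grind
      obtain ⟨s₅, h₅, hn₅⟩ := hdom c₀ hc₀'.2.2.2.2
      have h₅' : s₅ = x ∨ s₅ = b ∨ s₅ ∈ C := by
        have := hsplit s₅ (Finset.mem_inter.1 h₅).2
        simp only [hR] at hn₅
        grind
      rw [Finset.two_lt_card]
      by_cases hCS : ∃ s ∈ S' ∩ A, s ∈ C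
      · obtain ⟨s, hs, hsC⟩ := hCS
        refine ⟨s₁, h₁, s₂, h₂, s, hs, ?_, ?_, ?_⟩ <;> grind
      · push Not at hCS
        have h3 : s₃ = u := h₃'.resolve_right (hCS s₃ h₃)
        have h4 : s₄ = a := h₄'.resolve_right (hCS s₄ h₄)
        refine ⟨s₃, h₃, s₄, h₄, s₅, h₅, ?_, ?_, ?_⟩ <;> grind
    refine ⟨(S' \ A) ∪ {x, a}, fun v => ?_, ?_⟩
    · by_cases hv : v ∈ A
      · by_cases hvx : v = x
        · exact ⟨a, by simp, hclique v hv a haA (by rw [hvx]; exact hax.symm)⟩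
        · exact ⟨x, by simp, hclique v hv x hx hvx⟩
      · obtain ⟨s, hs, h⟩ := hS' v
        refine ⟨s, Finset.mem_union_left _ (Finset.mem_sdiff.2 ⟨hs, fun hsA => ?_⟩), h.1⟩
        exact hv (hA s hsA v h.1.symm)
    · have h1 := Finset.card_union_le (S' \ A) {x, a}
      have h2 : ({x, a} : Finset V).card ≤ 2 := Finset.card_le_two
      have h3 := Finset.card_sdiff_add_card_inter S' A
      omega

variable [Fintype V] {G : SimpleGraph V}

lemma IsTriangleComponent.notMem_active {a b c : V} (h : IsTriangleComponent G a b c) :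
    a ∉ active G := by
  have key : ∀ v ∈ ({a, b, c} : Set V), ∃ p q, IsTriangleComponent G v p q ∧
      p ∈ ({a, b, c} : Set V) ∧ q ∈ ({a, b, c} : Set V) := by
    rintro v (rfl | rfl | rfl)
    · exact ⟨b, c, h, by simp, by simp⟩
    · exact ⟨c, a, h.rotate, by simp, by simp⟩
    · exact ⟨a, b, h.rotate.rotate, by simp, by simp⟩
  refine notMem_active_of_closed {a, b, c} ?_ ?_ (by simp)
  · intro v hv d hd
    obtain ⟨p, q, ht, hp, hq⟩ := key v hv
    rcases (ht.1 d).1 hd with rfl | rfl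
    exacts [hp, hq]
  · intro v hv d hd
    obtain ⟨p, q, ht, -, -⟩ := key v hv
    rcases (ht.1 d).1 hd.adj with rfl | rfl
    exacts [hd.not_triangle _ ht, hd.not_triangle _ ht.swap]

/-- If some active vertex has degree at most two, then there is such a vertex to which
`exists_step_of_vertex` applies: a leaf, or, in the absence of leaves, any vertex of degree
two. -/
lemma exists_vertex_of_low_degree
    (h : ∃ y ∈ active G, ∃ a b, ∀ u, G.Adj y u → u = a ∨ u = b) :
    ∃ y ∈ active G, degIn G Finset.univ y ≤ 2 ∧ ∀ x, G.Adj y x →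
      ∃ z, z ≠ y ∧ G.Adj x z ∧ ∃ w, w ≠ x ∧ w ≠ y ∧ G.Adj z w := by
  have hdeg : ∀ y a b, (∀ u, G.Adj y u → u = a ∨ u = b) → degIn G Finset.univ y ≤ 2 := by
    intro y a b h
    have : Finset.univ.filter (G.Adj y) ⊆ {a, b} := by
      intro u hu
      have := h u (Finset.mem_filter.1 hu).2
      simpa using this
    exact (Finset.card_le_card this).trans Finset.card_le_two
  by_cases hleaf : ∃ y ∈ active G, ∃ x, ∀ u, G.Adj y u → u = x
  · obtain ⟨y, hy, x, hx⟩ := hleaf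
    refine ⟨y, hy, hdeg y x x fun u hu => Or.inl (hx u hu), fun x' hyx' => ?_⟩
    obtain rfl := hx x' hyx'
    by_contra hcon
    push Not at hcon
    refine (notMem_active_of_star (x := x') fun p hp c hpc => ?_).2 y hyx'.symm hy
    by_cases hpy : p = y
    · subst hpy; exact hx c hpc
    · by_contra hc
      refine hcon p hpy hp c hc ?_ hpc
      rintro rfl
      exact hp.ne (hx p hpc.symm).symm
  · push Not at hleaf
    obtain ⟨y, hy, a, b, hab⟩ := h
    refine ⟨y, hy, hdeg y a b hab, fun x hyx => ?_⟩
    by_contra hcon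
    push Not at hcon
    obtain ⟨x₂, hyx₂, hne⟩ := hleaf y hy x
    have hy2 : ∀ u, G.Adj y u → u = x ∨ u = x₂ := by
      intro u hu
      rcases hab u hu with h1 | h1 <;> rcases hab x hyx with h2 | h2 <;>
        rcases hab x₂ hyx₂ with h3 | h3 <;> grind
    have hxA := active_closed hy hyx
    -- Every other neighbour `z` of `x` is adjacent to `x` and `y` only.
    have hz : ∀ z, G.Adj x z → z ≠ y → G.Adj z y ∧ z = x₂ := by
      intro z hxz hzy
      obtain ⟨u, hzu, hux⟩ := hleaf z (active_closed hxA hxz) x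
      have huy : u = y := by
        by_contra huy
        exact hcon z hzy hxz u hux huy hzu
      subst huy
      exact ⟨hzu, (hy2 z hzu.symm).resolve_left hxz.ne'⟩
    obtain ⟨z, hxz, hzy⟩ := hleaf x hxA y
    obtain ⟨hzy', rfl⟩ := hz z hxz hzy
    refine IsTriangleComponent.notMem_active (G := G) (a := y) (b := x) (c := z)
      ⟨fun d => ⟨hy2 d, ?_⟩, fun d => ⟨fun hd => ?_, ?_⟩, fun d => ⟨fun hd => ?_, ?_⟩⟩ hy
    · rintro (rfl | rfl); exacts [hyx, hzy'.symm]
    · by_cases hdy : d = y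
      exacts [Or.inl hdy, Or.inr (hz d hd hdy).2]
    · rintro (rfl | rfl); exacts [hyx.symm, hxz]
    · by_contra hcon'
      push Not at hcon'
      exact hcon z hzy hxz d hcon'.2 hcon'.1 hd
    · rintro (rfl | rfl); exacts [hzy', hxz.symm]

lemma exists_isActiveEdge {m : Equiv.Perm V} (hm : IsMatchingPerm G m) {S : Finset V}
    (hS : IsTotalDominatingSet G S) (hlt : S.card < m.support.card) :
    ∃ a b, IsActiveEdge G a b := by
  by_contra h
  push Not at h
  exact absurd (card_support_le_of_inactive h hm hS) (by omega)

lemma IsActiveEdge.mem_active {a b : V} (h : IsActiveEdge G a b) : a ∈ active G :=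
  TotalBondage.mem_active.2 ⟨a, b, SimpleGraph.Reachable.refl _, h⟩

lemma IsActiveEdge.three_le_card {a b : V} (h : IsActiveEdge G a b) :
    3 ≤ (active G).card := by
  obtain ⟨c, hcb, hac⟩ := h.left
  exact Finset.two_lt_card.2 ⟨a, h.mem_active, b, active_closed h.mem_active h.adj, c,
    active_closed h.mem_active hac, h.adj.ne, hac.ne, hcb.symm⟩

/-- If the total domination number is at most `2μ - 2`, where `μ` is the matching number, then two
can be gained by deleting at most `2s - 4` edges, where `s` is the number of active vertices.
Vertices of degree at most two allow to gain one twice; when there are none left, an edge is split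
off. -/
lemma exists_step_two (hG : ∀ v, ∃ w, G.Adj v w) {m : Equiv.Perm V} (hm : IsMatchingPerm G m)
    {S : Finset V} (hS : IsTotalDominatingSet G S) (hSm : S.card + 2 ≤ m.support.card) :
    ∃ G' c, c + 4 ≤ 2 * (active G).card ∧ IsStep G G' c 2 ∧
      (active G').card + 2 ≤ (active G).card ∧
      ∃ m', IsMatchingPerm G' m' ∧ m.support.card ≤ m'.support.card := by
  obtain ⟨a, b, hab⟩ := exists_isActiveEdge hm hS (by omega)
  have h3 := hab.three_le_card
  have hclosed : ∀ a ∈ active G, ∀ b, G.Adj a b → b ∈ active G := fun a ha b => active_closed ha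
  have hshrink : ∀ G' : SimpleGraph V, G' ≤ G →
      (∃ x ∈ active G, ∃ y ∈ active G, x ≠ y ∧ x ∉ active G' ∧ y ∉ active G') →
      (active G').card + 2 ≤ (active G).card := by
    rintro G' hle ⟨x, hx, y, hy, hxy, hx', hy'⟩
    have hsub : active G' ⊆ ((active G).erase x).erase y := by
      intro v hv
      refine Finset.mem_erase.2 ⟨?_, Finset.mem_erase.2 ⟨?_, active_mono hle hv⟩⟩
      · rintro rfl; exact hy' hv
      · rintro rfl; exact hx' hv
    have h1 := Finset.card_le_card hsub
    have h2 := Finset.card_erase_add_one (Finset.mem_erase.2 ⟨hxy.symm, hy⟩)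
    have h3 := Finset.card_erase_add_one hx
    omega
  have hthree : ∀ H : SimpleGraph V,
      (¬ ∃ y ∈ active H, ∃ a b, ∀ u, H.Adj y u → u = a ∨ u = b) →
      ∀ v ∈ active H, ∀ a b, ∃ u, H.Adj v u ∧ u ≠ a ∧ u ≠ b := by
    intro H h v hv a b
    push Not at h
    exact h v hv a b
  by_cases hlow : ∃ y ∈ active G, ∃ a b, ∀ u, G.Adj y u → u = a ∨ u = b
  · obtain ⟨y, hy, hdeg, hgood⟩ := exists_vertex_of_low_degree hlow
    obtain ⟨G₁, c₁, hc₁, hs₁, hA₁, m₁, hm₁, hcard₁⟩ := exists_step_of_vertex hG hy hgood hm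
    by_cases hex : ∃ S₁, IsTotalDominatingSet G₁ S₁ ∧ S₁.card < m₁.support.card
    · obtain ⟨S₁, hS₁, hlt₁⟩ := hex
      obtain ⟨a₁, b₁, hab₁⟩ := exists_isActiveEdge hm₁ hS₁ hlt₁
      by_cases hlow₁ : ∃ y ∈ active G₁, ∃ a b, ∀ u, G₁.Adj y u → u = a ∨ u = b
      · obtain ⟨y₁, hy₁, hdeg₁, hgood₁⟩ := exists_vertex_of_low_degree hlow₁
        obtain ⟨G₂, c₂, hc₂, hs₂, hA₂, m₂, hm₂, hcard₂⟩ :=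
          exists_step_of_vertex hs₁.exists_adj hy₁ hgood₁ hm₁
        exact ⟨G₂, c₁ + c₂, by omega, hs₁.trans hs₂, by omega, m₂, hm₂, by omega⟩
      · -- The first step is undone: its result only certifies that an edge of `G` can be
        -- split off.
        obtain ⟨m', hm', hmax⟩ := exists_max_matching G₁
        obtain ⟨G', c, hc, hs, hxy, m'', hm'', hcard''⟩ := exists_pair_step hs₁.le
          hs₁.exists_adj hclosed (fun a ha b => active_closed ha) (active_mono hs₁.le)
          ⟨a₁, hab₁.mem_active⟩ (hthree G₁ hlow₁) hm' hmax
        have := hmax m₁ hm₁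
        exact ⟨G', c, hc, hs, hshrink G' hs.le hxy, m'', hm'', by omega⟩
    · push Not at hex
      refine ⟨G₁, c₁, by omega, ⟨hs₁.le, hs₁.exists_adj, hs₁.cost_le, fun S' hS' =>
        ⟨S, hS, ?_⟩⟩, hA₁, m₁, hm₁, hcard₁.ge⟩
      have := hex S' hS'
      omega
  · obtain ⟨m', hm', hmax⟩ := exists_max_matching G
    obtain ⟨G', c, hc, hs, hxy, m'', hm'', hcard''⟩ := exists_pair_step le_rfl hG hclosed
      hclosed subset_rfl ⟨a, hab.mem_active⟩ (hthree G hlow) hm' hmax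
    have := hmax m hm
    exact ⟨G', c, hc, hs, hshrink G' hs.le hxy, m'', hm'', by omega⟩

/-- If the total domination number is less than twice the matching number, then one can be gained
by deleting at most `2s - 5` edges, where `s ≥ 5` is the number of active vertices, or `2s - 4`
edges if `s ≤ 4`. -/
lemma exists_step_one (hG : ∀ v, ∃ w, G.Adj v w) {m : Equiv.Perm V} (hm : IsMatchingPerm G m)
    {S : Finset V} (hS : IsTotalDominatingSet G S) (hSm : S.card < m.support.card) :
    ∃ G' c, c + 4 ≤ 2 * (active G).card ∧ (c + 5 ≤ 2 * (active G).card ∨ (active G).card ≤ 4) ∧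
      IsStep G G' c 1 := by
  obtain ⟨a, b, hab⟩ := exists_isActiveEdge hm hS hSm
  have h3 := hab.three_le_card
  by_cases hlow : ∃ y ∈ active G, ∃ a b, ∀ u, G.Adj y u → u = a ∨ u = b
  · obtain ⟨y, hy, hdeg, hgood⟩ := exists_vertex_of_low_degree hlow
    obtain ⟨G₁, c₁, hc₁, hs₁, -⟩ := exists_step_of_vertex hG hy hgood hm
    exact ⟨G₁, c₁, by omega, by omega, hs₁⟩
  push Not at hlow
  have hvertex : ∀ y ∈ active G, ∃ G' c,
      c + 3 ≤ (active G).card + degIn G Finset.univ y ∧ IsStep G G' c 1 := by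
    intro y hy
    obtain ⟨G₁, c₁, hc₁, hs₁, -⟩ := exists_step_of_vertex hG hy (fun x hyx => by
      obtain ⟨z, hxz, hzy, -⟩ := hlow x (active_closed hy hyx) y y
      obtain ⟨w, hzw, hwx, hwy⟩ := hlow z (active_closed (active_closed hy hyx) hxz) x y
      exact ⟨z, hzy, hxz, w, hwx, hwy, hzw⟩) hm
    exact ⟨G₁, c₁, hc₁, hs₁⟩
  have hdeg : ∀ y ∈ active G, Finset.univ.filter (G.Adj y) ⊆ (active G).erase y := by
    intro y hy v hv
    have hv := (Finset.mem_filter.1 hv).2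
    exact Finset.mem_erase.2 ⟨hv.ne', active_closed hy hv⟩
  by_cases hclique : ∀ a ∈ active G, ∀ b ∈ active G, a ≠ b → G.Adj a b
  · by_cases hcard : 5 ≤ (active G).card
    · obtain ⟨G', c, hc, hs⟩ := exists_clique_step hG (fun a ha b => active_closed ha) hclique
        hcard
      exact ⟨G', c, by omega, Or.inl hc, hs⟩
    · obtain ⟨G', c, hc, hs⟩ := hvertex a hab.mem_active
      have h1 : degIn G Finset.univ a ≤ _ := Finset.card_le_card (hdeg a hab.mem_active)
      have h2 := Finset.card_erase_add_one hab.mem_active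
      exact ⟨G', c, by omega, Or.inr (by omega), hs⟩
  · push Not at hclique
    obtain ⟨y, hy, v, hv, hyv, hn⟩ := hclique
    obtain ⟨G', c, hc, hs⟩ := hvertex y hy
    have hsub : Finset.univ.filter (G.Adj y) ⊆ ((active G).erase y).erase v := by
      intro w hw
      refine Finset.mem_erase.2 ⟨?_, hdeg y hy hw⟩
      rintro rfl
      exact hn (Finset.mem_filter.1 hw).2
    have h1 : degIn G Finset.univ y ≤ _ := Finset.card_le_card hsub
    have h2 := Finset.card_erase_add_one hy
    have h3 := Finset.card_erase_add_one (Finset.mem_erase.2 ⟨hyv.symm, hv⟩)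
    exact ⟨G', c, by omega, Or.inl (by omega), hs⟩

end Gain

/-! ### Comparison with the complete graph -/

section Main

open scoped Classical

/-- The number of edges whose deletion from a graph with `N` active vertices suffices to gain `k`:
two at a time, and one at the end if `k` is odd. -/
def budget : ℕ → ℕ → ℕ
  | _, 0 => 0
  | N, 1 => if N = 4 then 4 else 2 * N - 5
  | N, k + 2 => (2 * N - 4) + budget (N - 2) k

/-- Twice the budget for even `k` is the number of ordered pairs of distinct vertices minus the
bound of `degSum_le_of_le_card`. -/
lemma budget_of_even {N k : ℕ} (hk : Even k) (h : k + 2 ≤ N) :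
    2 * (budget N k : ℤ) + (N + ((N : ℤ) - k - 2) ^ 2 + 2 * ((N : ℤ) - k - 2)) =
      N * (N - 1) := by
  induction k using Nat.twoStepInduction generalizing N with
  | zero => simp only [budget]; push_cast; ring
  | one => exact absurd hk (by decide)
  | more k ih _ =>
    obtain ⟨M, rfl⟩ := Nat.exists_eq_add_of_le' (show 2 ≤ N by omega)
    have := ih (N := M) ((Nat.even_add.1 hk).2 (by decide)) (by omega)
    simp only [budget, Nat.add_sub_cancel]
    have h2 : 2 * (M + 2) - 4 = 2 * M := by omega
    rw [h2]
    push_cast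
    linarith

/-- Twice the budget for odd `k` is the number of ordered pairs of distinct vertices minus the
bound of `degSum_le_of_le_card_of_odd`. -/
lemma budget_of_odd {N k : ℕ} (hk : Odd k) (h : k + 3 ≤ N) :
    ((N : ℤ) - k - 2 ≤ 1 → 2 * (budget N k : ℤ) + N = N * (N - 1)) ∧
      (2 ≤ (N : ℤ) - k - 2 →
        2 * (budget N k : ℤ) + (N + ((N : ℤ) - k - 2) ^ 2 + 1) = N * (N - 1)) := by
  induction k using Nat.twoStepInduction generalizing N with
  | zero => exact absurd hk (by decide)
  | one =>
    simp only [budget]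
    constructor
    · intro h'
      obtain rfl : N = 4 := by omega
      norm_num
    · intro h'
      rw [if_neg (by omega)]
      obtain ⟨M, rfl⟩ := Nat.exists_eq_add_of_le' (show 5 ≤ N by omega)
      have h2 : 2 * (M + 5) - 5 = 2 * M + 5 := by omega
      rw [h2]
      push_cast
      ring
  | more k ih _ =>
    obtain ⟨M, rfl⟩ := Nat.exists_eq_add_of_le' (show 2 ≤ N by omega)
    have := ih (N := M) (by
      rw [← Nat.not_even_iff_odd] at hk ⊢
      exact fun h => hk (h.add (by decide))) (by omega)
    simp only [budget, Nat.add_sub_cancel]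
    have h2 : 2 * (M + 2) - 4 = 2 * M := by omega
    rw [h2]
    push_cast
    refine ⟨fun h => ?_, fun h => ?_⟩
    · have := this.1 (by linarith)
      linarith
    · have := this.2 (by linarith)
      linarith

variable {V : Type*} {G : SimpleGraph V}

lemma IsStep.le_card {G' : SimpleGraph V} {c b g : ℕ} (h : IsStep G G' c b)
    (hg : ∀ S, IsTotalDominatingSet G S → g ≤ S.card) :
    ∀ S, IsTotalDominatingSet G' S → g + b ≤ S.card := by
  intro S' hS'
  obtain ⟨S, hS, h'⟩ := h.gain_le S' hS'
  have := hg S hS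
  omega

lemma noIsolatedVertex_iff : NoIsolatedVertex G ↔ ∀ v, ∃ w, G.Adj v w := by
  simp [NoIsolatedVertex, SimpleGraph.IsIsolated]

lemma totalDominationNumber_le {S : Finset V} (hS : IsTotalDominatingSet G S) :
    totalDominationNumber G ≤ S.card :=
  Nat.sInf_le ⟨S, hS, rfl⟩

variable [Fintype V]

/-- If all total dominating sets of `G` have at least `g` elements and `G` has a matching with at
least `(g + k) / 2` edges, then deleting at most `budget N k` edges makes `g + k` a lower bound.
-/
theorem exists_steps (k : ℕ) {N g : ℕ} (hG : ∀ v, ∃ w, G.Adj v w) {m : Equiv.Perm V}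
    (hm : IsMatchingPerm G m) (hg : ∀ S, IsTotalDominatingSet G S → g ≤ S.card)
    (hgk : g + k ≤ m.support.card) (hN : (active G).card ≤ N) (hkN : k + 2 ≤ N)
    (hkN' : Odd k → k + 3 ≤ N) :
    ∃ G' c, c ≤ budget N k ∧ IsStep G G' c 0 ∧
      ∀ S, IsTotalDominatingSet G' S → g + k ≤ S.card := by
  induction k using Nat.twoStepInduction generalizing N g G m with
  | zero => exact ⟨G, 0, by simp, IsStep.refl hG, by simpa using hg⟩
  | one =>
    by_cases hex : ∃ S, IsTotalDominatingSet G S ∧ S.card < m.support.card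
    · obtain ⟨S, hS, hlt⟩ := hex
      obtain ⟨G', c, hc, hc', hs⟩ := exists_step_one hG hm hS hlt
      refine ⟨G', c, ?_, ⟨hs.le, hs.exists_adj, hs.cost_le, fun S' hS' => ?_⟩, hs.le_card hg⟩
      · have := hkN' (by decide)
        simp only [budget]
        split_ifs <;> omega
      · obtain ⟨S, hS, h⟩ := hs.gain_le S' hS'
        exact ⟨S, hS, by omega⟩
    · push Not at hex
      exact ⟨G, 0, by simp, IsStep.refl hG, fun S hS => hgk.trans (hex S hS)⟩
  | more k ih _ =>
    have hweak : ∀ {G₁ G₂ : SimpleGraph V} {c b : ℕ}, IsStep G₁ G₂ c b → IsStep G₁ G₂ c 0 := by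
      intro G₁ G₂ c b hs
      refine ⟨hs.le, hs.exists_adj, hs.cost_le, fun S' hS' => ?_⟩
      obtain ⟨S, hS, h⟩ := hs.gain_le S' hS'
      exact ⟨S, hS, by omega⟩
    by_cases hex : ∃ S, IsTotalDominatingSet G S ∧ S.card + 2 ≤ m.support.card
    · obtain ⟨S, hS, hlt⟩ := hex
      obtain ⟨G₁, c₁, hc₁, hs₁, hA₁, m₁, hm₁, hcard₁⟩ := exists_step_two hG hm hS hlt
      obtain ⟨G', c, hc, hs, hlow⟩ := ih (N := N - 2) (g := g + 2) hs₁.exists_adj hm₁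
        (hs₁.le_card hg) (by omega) (by omega) (by omega) (fun hk => by
          have := hkN' (by
            rw [← Nat.not_even_iff_odd] at hk ⊢
            exact fun h => hk ((Nat.even_add.1 h).2 (by decide)))
          omega)
      refine ⟨G', c₁ + c, ?_, hweak (hs₁.trans hs), fun S' hS' => ?_⟩
      · simp only [budget]
        omega
      · have := hlow S' hS'
        omega
    push Not at hex
    by_cases hex' : ∃ S, IsTotalDominatingSet G S ∧ S.card < m.support.card
    · obtain ⟨S, hS, hlt⟩ := hex'
      obtain ⟨G', c, hc, -, hs⟩ := exists_step_one hG hm hS hlt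
      refine ⟨G', c, ?_, hweak hs, fun S' hS' => ?_⟩
      · simp only [budget]
        omega
      · obtain ⟨S₁, hS₁, h⟩ := hs.gain_le S' hS'
        have := hex S₁ hS₁
        omega
    · push Not at hex'
      exact ⟨G, 0, by simp, IsStep.refl hG, fun S hS => hgk.trans (hex' S hS)⟩

/-- The absence of isolated vertices makes the total domination number a genuine minimum. -/
lemma le_totalDominationNumber (hG : ∀ v, ∃ w, G.Adj v w) {t : ℕ}
    (h : ∀ S, IsTotalDominatingSet G S → t ≤ S.card) : t ≤ totalDominationNumber G := by
  refine le_csInf ?_ ?_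
  · refine ⟨_, Finset.univ, fun v => ?_, rfl⟩
    obtain ⟨w, hw⟩ := hG v
    exact ⟨w, Finset.mem_univ _, hw⟩
  · rintro _ ⟨S, hS, rfl⟩
    exact h S hS

/-- A matching that is large enough yields a bondage set within the budget. -/
lemma exists_isBondageSet (hG : ∀ v, ∃ w, G.Adj v w) {m : Equiv.Perm V}
    (hm : IsMatchingPerm G m) {k : ℕ} (hk : totalDominationNumber G + k ≤ m.support.card)
    (hkN : k + 2 ≤ Fintype.card V) (hkN' : Odd k → k + 3 ≤ Fintype.card V) :
    ∃ D, IsBondageSet G k D ∧ D.card ≤ budget (Fintype.card V) k := by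
  obtain ⟨G', c, hc, hs, hlow⟩ := exists_steps k hG hm
    (fun S hS => totalDominationNumber_le hS) hk (Finset.card_le_univ _) hkN hkN'
  obtain ⟨D, hD, hdel⟩ := hs.cost_le
  set D' := D.filter (fun e => e ∈ G.edgeSet ∧ e ∉ G'.edgeSet) with hD'
  have hdelete : G.deleteEdges (D' : Set (Sym2 V)) = G' := by
    ext a b
    simp only [SimpleGraph.deleteEdges_adj, hD', Finset.coe_filter, Set.mem_ofPred_eq,
      SimpleGraph.mem_edgeSet]
    constructor
    · rintro ⟨hab, h⟩
      by_contra hn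
      exact h ⟨hdel a b hab hn, hab, hn⟩
    · exact fun h => ⟨hs.le h, fun h' => h'.2.2 h⟩
  refine ⟨D', ⟨?_, ?_, ?_⟩, (Finset.card_filter_le _ _).trans (hD.trans hc)⟩
  · intro e he
    exact (Finset.mem_filter.1 (Finset.mem_coe.1 he)).2.1
  · rw [hdelete, noIsolatedVertex_iff]
    exact hs.exists_adj
  · rw [hdelete]
    exact le_totalDominationNumber hs.exists_adj hlow

/-- The existence of a bondage set forces a matching that is large enough. -/
lemma IsBondageSet.exists_matching {k : ℕ} {D : Finset (Sym2 V)} (h : IsBondageSet G k D) :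
    (∀ v, ∃ w, G.Adj v w) ∧ ∃ m : Equiv.Perm V, IsMatchingPerm G m ∧
      totalDominationNumber G + k ≤ m.support.card := by
  have hno := noIsolatedVertex_iff.1 h.2.1
  have hle : G.deleteEdges (D : Set (Sym2 V)) ≤ G := SimpleGraph.deleteEdges_le _
  obtain ⟨m, hm, hmax⟩ := exists_max_matching (G.deleteEdges (D : Set (Sym2 V)))
  refine ⟨fun v => ?_, m, hm.mono hle, h.2.2.trans ?_⟩
  · obtain ⟨w, hw⟩ := hno v
    exact ⟨w, hle hw⟩
  · exact totalDominationNumber_le (isTotalDominatingSet_support hno hm hmax)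

/-- Every bondage set of the complete graph has at least as many elements as the budget: the
remaining graph has total domination number at least `k + 2`, hence few edges. -/
lemma budget_le_card {k : ℕ} {D : Finset (Sym2 V)} (h : IsBondageSet (⊤ : SimpleGraph V) k D)
    [Nonempty V] (hkN : k + 2 ≤ Fintype.card V) (hkN' : Odd k → k + 3 ≤ Fintype.card V) :
    budget (Fintype.card V) k ≤ D.card := by
  set H := (⊤ : SimpleGraph V).deleteEdges (D : Set (Sym2 V)) with hH
  have hno : ∀ v, ∃ w, H.Adj v w := noIsolatedVertex_iff.1 h.2.1
  have hnoTop : ∀ v : V, ∃ w, (⊤ : SimpleGraph V).Adj v w := fun v => by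
    obtain ⟨w, hw⟩ := hno v
    exact ⟨w, SimpleGraph.deleteEdges_le _ hw⟩
  have htwo : 2 ≤ totalDominationNumber (⊤ : SimpleGraph V) := by
    refine le_totalDominationNumber hnoTop fun S hS => ?_
    obtain ⟨a, ha, -⟩ := hS (Classical.arbitrary V)
    obtain ⟨b, hb, hab⟩ := hS a
    exact Finset.one_lt_card.2 ⟨a, ha, b, hb, hab.ne⟩
  have hlow : ∀ T ⊆ (Finset.univ : Finset V), Dominates H T Finset.univ →
      ((k : ℤ) + 2) ≤ T.card := by
    intro T _ hT
    have h1 := totalDominationNumber_le (G := H) (S := T) fun v => hT v (Finset.mem_univ v)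
    have h2 : totalDominationNumber (⊤ : SimpleGraph V) + k ≤ totalDominationNumber H := h.2.2
    have h3 : k + 2 ≤ T.card := by omega
    exact_mod_cast h3
  have hdom : Dominates H Finset.univ Finset.univ := fun v _ => by
    obtain ⟨w, hw⟩ := hno v
    exact ⟨w, Finset.mem_univ w, hw⟩
  have hedges : (Fintype.card V : ℤ) * (Fintype.card V - 1) ≤
      degSum H Finset.univ + 2 * D.card := by
    have h1 : degSum (⊤ : SimpleGraph V) Finset.univ =
        2 * (⊤ : SimpleGraph V).edgeFinset.card := degSum_univ_eq _
    have h2 : degSum H Finset.univ = 2 * H.edgeFinset.card := degSum_univ_eq _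
    have h3 : degSum (⊤ : SimpleGraph V) Finset.univ =
        Fintype.card V * (Fintype.card V - 1) := by
      unfold degSum degIn
      rw [Finset.sum_congr rfl (g := fun _ => Fintype.card V - 1), Finset.sum_const,
        smul_eq_mul, Finset.card_univ]
      intro v _
      rw [← Finset.card_univ, ← Finset.card_erase_of_mem (Finset.mem_univ v)]
      congr 1
      ext w
      simp [eq_comm]
    have h4 : (⊤ : SimpleGraph V).edgeFinset.card ≤ H.edgeFinset.card + D.card := by
      refine (Finset.card_le_card (t := H.edgeFinset ∪ D) ?_).trans (Finset.card_union_le _ _)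
      intro e he
      rw [SimpleGraph.mem_edgeFinset] at he
      by_cases heD : e ∈ D
      · exact Finset.mem_union_right _ heD
      · refine Finset.mem_union_left _ ?_
        rw [SimpleGraph.mem_edgeFinset, hH, SimpleGraph.edgeSet_deleteEdges]
        exact ⟨he, heD⟩
    have h5 : Fintype.card V * (Fintype.card V - 1) ≤ degSum H Finset.univ + 2 * D.card := by
      omega
    have h6 : 1 ≤ Fintype.card V := by omega
    zify [h6] at h5
    exact h5
  have hcast : (Fintype.card V : ℤ) - (k + 2) = Fintype.card V - k - 2 := by ring
  suffices h : 2 * (budget (Fintype.card V) k : ℤ) ≤ 2 * D.card by omega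
  rcases Nat.even_or_odd k with hk | hk
  · have h1 := degSum_le_of_le_card _ hdom _ hlow
    rw [Finset.card_univ, hcast] at h1
    have h2 := budget_of_even hk hkN
    linarith
  · have hk' : Odd ((k : ℤ) + 2) := by
      obtain ⟨l, rfl⟩ := hk
      exact ⟨l + 1, by push_cast; ring⟩
    have h1 := degSum_le_of_le_card_of_odd _ hdom _ hk' hlow
    rw [Finset.card_univ, hcast] at h1
    have h2 := budget_of_odd hk (hkN' hk)
    rcases le_or_gt ((Fintype.card V : ℤ) - k - 2) 1 with h3 | h3
    · have := h1.1 h3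
      have := h2.1 h3
      linarith
    · have := h1.2 h3
      have := h2.2 h3
      linarith

/-- A maximum matching of the complete graph covers all vertices, or all but one if their number is
odd. -/
lemma exists_matching_top : ∃ m : Equiv.Perm V, IsMatchingPerm (⊤ : SimpleGraph V) m ∧
    2 * (Fintype.card V / 2) ≤ m.support.card := by
  obtain ⟨m, hm, hmax⟩ := exists_max_matching (⊤ : SimpleGraph V)
  refine ⟨m, hm, ?_⟩
  have h1 : (Finset.univ.filter fun v => m v = v).card ≤ 1 := by
    refine Finset.card_le_one.2 fun a ha b hb => ?_
    by_contra hab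
    obtain ⟨m', hm', hlt⟩ := exists_lt_of_unmatched hm (w := a) (z := b) hab
      (Finset.mem_filter.1 ha).2 (Finset.mem_filter.1 hb).2
    exact absurd (hmax m' hm') (by omega)
  have h2 := Finset.card_filter_add_card_filter_not (s := (Finset.univ : Finset V))
    (fun v => m v = v)
  have h3 : (Finset.univ.filter fun v => ¬ m v = v) = m.support := by
    ext v; simp
  rw [h3, Finset.card_univ] at h2
  have h4 : 2 ∣ m.support.card := Equiv.Perm.two_dvd_card_support (by
    rw [sq]
    exact Equiv.ext hm.inv)
  omega

lemma totalDominationNumber_top_le (h : 2 ≤ Fintype.card V) :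
    totalDominationNumber (⊤ : SimpleGraph V) ≤ 2 := by
  obtain ⟨a, b, hab⟩ := Fintype.exists_pair_of_one_lt_card h
  refine (totalDominationNumber_le (S := {a, b}) fun v => ?_).trans Finset.card_le_two
  by_cases hv : v = a
  · exact ⟨b, by simp, by simpa [hv] using hab⟩
  · exact ⟨a, by simp, by simpa using hv⟩

end Main

end TotalBondage

theorem mainTheorem12 {V : Type*} [Fintype V] (G : SimpleGraph V) (n : ℕ)
    (hcard : Fintype.card V = n) (hn : 5 ≤ n) (k : ℕ)
    (hk : (k : ℚ) ≤ (n : ℚ) - 2 + ((-1 : ℚ) ^ n - 1) / 2) :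
    TotalBondage.BondageNumberExists (⊤ : SimpleGraph V) k ∧
      (TotalBondage.BondageNumberExists G k →
        TotalBondage.bondageNumber G k ≤
          TotalBondage.bondageNumber (⊤ : SimpleGraph V) k) := by
  classical
  subst hcard
  have hk' : k + 2 ≤ 2 * (Fintype.card V / 2) := by
    rcases Nat.even_or_odd (Fintype.card V) with h | h
    · rw [h.neg_one_pow] at hk
      have : ((k + 2 : ℕ) : ℚ) ≤ (Fintype.card V : ℕ) := by push_cast; linarith
      have : k + 2 ≤ Fintype.card V := by exact_mod_cast this
      have := Nat.two_mul_div_two_of_even h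
      omega
    · rw [h.neg_one_pow] at hk
      have : ((k + 3 : ℕ) : ℚ) ≤ (Fintype.card V : ℕ) := by push_cast; linarith
      have : k + 3 ≤ Fintype.card V := by exact_mod_cast this
      have := Nat.two_mul_div_two_add_one_of_odd h
      omega
  have hkN : k + 2 ≤ Fintype.card V := by omega
  -- An odd `k` has a different parity than `2 * (n / 2)`.
  have hkN' : Odd k → k + 3 ≤ Fintype.card V := by
    rintro ⟨l, rfl⟩
    omega
  have : Nonempty V := Fintype.card_pos_iff.1 (by omega)
  have htop : TotalBondage.BondageNumberExists (⊤ : SimpleGraph V) k := by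
    obtain ⟨m, hm, hcard⟩ := TotalBondage.exists_matching_top (V := V)
    have h2 := TotalBondage.totalDominationNumber_top_le (V := V) (by omega)
    have : Nontrivial V := Fintype.one_lt_card_iff_nontrivial.1 (by omega)
    have hadj : ∀ v : V, ∃ w, (⊤ : SimpleGraph V).Adj v w := fun v => by
      obtain ⟨w, hw⟩ := exists_ne v
      exact ⟨w, hw.symm⟩
    obtain ⟨D, hD, -⟩ := TotalBondage.exists_isBondageSet hadj hm (by omega) hkN hkN'
    exact ⟨D, hD⟩
  refine ⟨htop, ?_⟩
  rintro ⟨D, hD⟩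
  obtain ⟨hG, m, hm, hmk⟩ := hD.exists_matching
  obtain ⟨D₁, hD₁, hcard₁⟩ := TotalBondage.exists_isBondageSet hG hm hmk hkN hkN'
  obtain ⟨D₂, hD₂⟩ := htop
  refine le_csInf ⟨_, D₂, hD₂, rfl⟩ ?_
  rintro _ ⟨D₃, hD₃, rfl⟩
  have hle : TotalBondage.bondageNumber G k ≤ D₁.card := Nat.sInf_le ⟨D₁, hD₁, rfl⟩
  exact hle.trans (hcard₁.trans (TotalBondage.budget_le_card hD₃ hkN hkN'))
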